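/- **Model.** Let $\mathcal A$ be a set of external actions, $\tau\notin\mathcal A$, $Act=\mathcal A\cup\{\tau\}$ and $Act_p=Act\cup\{p\tau\mid 0<p<1\}$. Terms of finite state randomized CCS are given by $T::=\mathbf 0\mid X\mid\sum_{i\in I}\alpha_i.T_i\mid\bigoplus_{i\in J}p_i\tau.T_i\mid\mu X.T$, where $\alpha_i\in Act$, $I,J$ are finite, $|I|\ge1$, $|J|\ge2$, $p_i\in(0,1)$ and $\sum_{i\in J}p_i=1$, and where in $\mu X.T$ every free occurrence of $X$ in $T$ lies inside a choice. A process is a term without free variables; $\mathcal P$ is the set of processes. Transitions: $\sum_i\alpha_i.T_i\xrightarrow{\alpha_i}T_i$, $\bigoplus_ip_i\tau.T_i\xrightarrow{p_i\tau}T_i$, and $\mu X.T\xrightarrow{\lambda}T'$ if $T\{\mu X.T/X\}\xrightarrow{\lambda}T'$. Collective silent transitions: $\bigoplus_{i}p_i\tau.T_i\to(p_i,T_i)_{i}$, and $\mu X.T$ has those of $T\{\mu X.T/X\}$. An immediate silent transition is a transition $A\xrightarrow{\tau}A'$ or a collective silent transition; it is state-preserving for an equivalence $\mathcal E$ if all its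 targets are $\mathcal E$-equivalent to its source. **Bisimilarity.** Let $\mathcal E$ be an equivalence. An $\epsilon$-tree of $A$ w.r.t. $\mathcal E$ is a (possibly infinite) tree with root labelled $A$ and all nodes labelled by elements of $[A]_{\mathcal E}$, in which a node labelled $B$ is a leaf, or has one child, labelled $B'$ with $B\xrightarrow{\tau}B'$, by an edge labelled $1$, or has $k\ge2$ children labelled $B_1,\dots,B_k$, by edges labelled $p_1,\dots,p_k$, where $B\to(p_i,B_i)_{i\le k}$ is a collective silent transition. The probability of a finite path is the product of its edge labels; $\mathsf P_k$ is the sum of the probabilities of the paths of length at most $k$ from the root to a leaf. The tree is regular if $\lim_k\mathsf P_k=1$, and divergent if $\lim_k\mathsf P_k=0$. Write $A\Uparrow_{\mathcal E}$ if $A$ has a divergent $\epsilon$-tree w.r.t. $\mathcal E$. For an $\mathcal E$-class $\mathcal C$: * for $\ell\in Act$ with $\ell\in\mathcal A$ or $\mathcal C\ne[A]_{\mathcal E}$, $A$ has an $\ell$-transition to $\mathcal C$ if some regular $\epsilon$-tree of $A$ is such that each of its leaves $L$ has a transition $L\xrightarrow{\ell}L'$ with $L'\in\mathcal C$; * for $\mathcal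 C\ne[A]_{\mathcal E}$, $A$ has a $q$-transition to $\mathcal C$ if some regular $\epsilon$-tree of $A$ is such that each of its leaves $L$ has a collective silent transition $L\to(p_i,L_i)_i$ with $\sum_{L_i\in[L]_{\mathcal E}}p_i<1$ and $\sum_{L_i\in\mathcal C}p_i\,/\,(1-\sum_{L_i\in[L]_{\mathcal E}}p_i)=q$. $\mathcal E$ is a branching bisimulation if $\mathcal E$-equivalent states have the same $\ell$- and $q$-transitions to $\mathcal E$-classes; it is one with explicit divergence if moreover $(A,B)\in\mathcal E$ implies $A\Uparrow_{\mathcal E}\iff B\Uparrow_{\mathcal E}$. Write $A\simeq^{\Delta}B$ if $(A,B)\in\mathcal E$ for some branching bisimulation with explicit divergence $\mathcal E$ on $\mathcal P$. **Algorithm.** $\mathsf{DetDivTree}(A,\mathcal E)$: let $(V,E)$ be the graph of all states reachable from $A$ by state-preserving immediate silent transitions, with the corresponding edges labelled $\tau$ or $p\tau$. Let $\mathcal L_{ndiv}$ be the set of its nodes without outgoing edge and $\mathcal L_{und}=V\setminus\mathcal L_{ndiv}$. Repeat: go once through the nodes $B$ of $\mathcal L_{und}$, moving $B$ at once from $\mathcal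 L_{und}$ to $\mathcal L_{ndiv}$ unless $B$ has a $\tau$-edge into $\mathcal L_{und}$, or has $p\tau$-edges and all $B''$ with $B\xrightarrow{q\tau}B''$ for some $q$ are in $\mathcal L_{und}$; stop after a pass in which nothing is moved. Return $\mathbf F$ if $A\in\mathcal L_{ndiv}$, else $\mathbf T$. $\mathsf{DivBranBisim}(A,B)$: let $R$ be the disjoint union of the sets of processes reachable from $A$ and from $B$, with the transitions inherited from $\mathcal P$, and $\mathcal E_{ini}=R\times R$. Repeat: let $\mathcal E=\mathsf{Quotient}(\mathcal E_{ini})$ be the largest branching bisimulation on $R$ contained in $\mathcal E_{ini}$, and search for a pair $(P,Q)\in\mathcal E$ with $\mathsf{DetDivTree}(P,\mathcal E)\ne\mathsf{DetDivTree}(Q,\mathcal E)$. If there is none, stop. Otherwise, for the first such pair found, let $\mathcal E_{ini}$ be obtained from $\mathcal E$ by splitting $[P]_{\mathcal E}$ into the set of its members on which $\mathsf{DetDivTree}(\cdot,\mathcal E)$ returns $\mathbf T$ and the set of those on which it returns $\mathbf F$. After the loop, return $\mathbf T$ if $(A,B)\in\mathcal E$, with $A$ taken in the first and $B$ in the second part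 of $R$, and $\mathbf F$ otherwise. **Theorem.** For all processes $A,B$, the set $R$ is finite, and, in whatever order finite sets are traversed, $\mathsf{DivBranBisim}(A,B)$ terminates, and it returns $\mathbf T$ if and only if $A\simeq^{\Delta}B$. -/

import Mathlib

open Filter Topology

namespace RCCS

universe u v

/-! ### The process calculus -/

/-- Actions: external actions, drawn from an arbitrary set `𝒜`, and the internal action `τ`. -/
inductive Act (𝒜 : Type u) : Type u
  | ext (a : 𝒜) : Act 𝒜
  | tau : Act 𝒜

/-- Transition labels: an action, or `pτ` with `0 < p < 1`. -/
inductive ActP (𝒜 : Type u) : Type u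
  | act (α : Act 𝒜) : ActP 𝒜
  | prob (p : Set.Ioo (0 : ℝ) 1) : ActP 𝒜

/-- Terms of finite state randomized CCS. Process variables are natural numbers. A nondeterministic
choice has `n + 1 ≥ 1` summands; a probabilistic choice has `n + 2 ≥ 2` summands, whose
probabilities lie in `(0,1)` and add up to `1`. -/
inductive Term (𝒜 : Type u) : Type u
  | nil : Term 𝒜
  | var (X : ℕ) : Term 𝒜
  | choice (n : ℕ) (α : Fin (n + 1) → Act 𝒜) (T : Fin (n + 1) → Term 𝒜) : Term 𝒜
  | pchoice (n : ℕ) (p : Fin (n + 2) → Set.Ioo (0 : ℝ) 1) (hp : ∑ i, (p i : ℝ) = 1)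
      (T : Fin (n + 2) → Term 𝒜) : Term 𝒜
  | mu (X : ℕ) (T : Term 𝒜) : Term 𝒜

namespace Term

variable {𝒜 : Type u}

/-- Free variables. -/
def fv : Term 𝒜 → Set ℕ
  | nil => ∅
  | var X => {X}
  | choice _ _ T => ⋃ i, (T i).fv
  | pchoice _ _ _ T => ⋃ i, (T i).fv
  | mu X T => T.fv \ {X}

/-- `T.Guarded X`: every free occurrence of `X` in `T` lies inside a (nondeterministic or
probabilistic) choice. -/
def Guarded (X : ℕ) : Term 𝒜 → Prop
  | nil => True
  | var Y => Y ≠ X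
  | choice _ _ _ => True
  | pchoice _ _ _ _ => True
  | mu Y T => Y = X ∨ T.Guarded X

/-- In every subterm `μX.T`, the variable `X` is guarded in `T`. -/
def WF : Term 𝒜 → Prop
  | nil => True
  | var _ => True
  | choice _ _ T => ∀ i, (T i).WF
  | pchoice _ _ _ T => ∀ i, (T i).WF
  | mu X T => T.Guarded X ∧ T.WF

/-- `T.subst X P` is `T{P/X}`: every free occurrence of `X` in `T` is replaced by `P`. It is only
used for closed terms `P`, where no variable can be captured. -/
def subst : Term 𝒜 → ℕ → Term 𝒜 → Term 𝒜
  | nil, _, _ => nil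
  | var Y, X, P => if Y = X then P else var Y
  | choice n α T, X, P => choice n α fun i => (T i).subst X P
  | pchoice n p hp T, X, P => pchoice n p hp fun i => (T i).subst X P
  | mu Y T, X, P => if Y = X then mu Y T else mu Y (T.subst X P)

/-- The labelled transition system on terms. -/
inductive Step : Term 𝒜 → ActP 𝒜 → Term 𝒜 → Prop
  | choice (n : ℕ) (α : Fin (n + 1) → Act 𝒜) (T : Fin (n + 1) → Term 𝒜) (i : Fin (n + 1)) :
      Step (.choice n α T) (.act (α i)) (T i)
  | pchoice (n : ℕ) (p : Fin (n + 2) → Set.Ioo (0 : ℝ) 1) (hp : ∑ i, (p i : ℝ) = 1)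
      (T : Fin (n + 2) → Term 𝒜) (i : Fin (n + 2)) :
      Step (.pchoice n p hp T) (.prob (p i)) (T i)
  | mu (X : ℕ) (T : Term 𝒜) (l : ActP 𝒜) (T' : Term 𝒜) :
      Step (T.subst X (.mu X T)) l T' → Step (.mu X T) l T'

/-- Collective silent transitions: `Coll T k p Q` says that `T` has the collective silent
transition with probabilities `p 0, …, p (k-1)` to the respective targets `Q 0, …, Q (k-1)`. -/
inductive Coll : Term 𝒜 → (k : ℕ) → (Fin k → Set.Ioo (0 : ℝ) 1) → (Fin k → Term 𝒜) → Prop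
  | pchoice (n : ℕ) (p : Fin (n + 2) → Set.Ioo (0 : ℝ) 1) (hp : ∑ i, (p i : ℝ) = 1)
      (T : Fin (n + 2) → Term 𝒜) : Coll (.pchoice n p hp T) (n + 2) p T
  | mu (X : ℕ) (T : Term 𝒜) (k : ℕ) (p : Fin k → Set.Ioo (0 : ℝ) 1) (Q : Fin k → Term 𝒜) :
      Coll (T.subst X (.mu X T)) k p Q → Coll (.mu X T) k p Q

end Term

/-- Processes: guarded terms without free variables. -/
def Proc (𝒜 : Type u) : Type u := {T : Term 𝒜 // T.WF ∧ T.fv = ∅}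

/-! ### Transition systems

The notions below are needed on the set of all processes and on the finite set of states on which
the algorithm operates, hence they are set up for an arbitrary set `S` of states. -/

/-- Labelled transitions and collective silent transitions on a set `S` of states. -/
structure TransSystem (𝒜 : Type u) (S : Type v) where
  step : S → ActP 𝒜 → S → Prop
  coll : S → (k : ℕ) → (Fin k → Set.Ioo (0 : ℝ) 1) → (Fin k → S) → Prop

/-- The transition system of all processes. -/
def rccs (𝒜 : Type u) : TransSystem 𝒜 (Proc 𝒜) where
  step P l Q := Term.Step P.1 l Q.1
  coll P k p Q := Term.Coll P.1 k p fun i => (Q i).1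

namespace TransSystem

variable {𝒜 : Type u} {S : Type v}

/-- The set of states reachable from `A`. -/
def reach (M : TransSystem 𝒜 S) (A : S) : Set S :=
  {B | Relation.ReflTransGen (fun P Q => ∃ l, M.step P l Q) A B}

/-- The restriction of a transition system to a set of states. -/
def restrict (M : TransSystem 𝒜 S) (V : Set S) : TransSystem 𝒜 V where
  step P l Q := M.step P l Q
  coll P k p Q := M.coll P k p fun i => Q i

/-- The disjoint union of two transition systems. -/
def disjUnion {S' : Type v} (M : TransSystem 𝒜 S) (N : TransSystem 𝒜 S') :
    TransSystem 𝒜 (S ⊕ S') where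
  step
    | .inl P, l, .inl Q => M.step P l Q
    | .inr P, l, .inr Q => N.step P l Q
    | _, _, _ => False
  coll
    | .inl P, k, p, Q => ∃ Q' : Fin k → S, (∀ i, Q i = .inl (Q' i)) ∧ M.coll P k p Q'
    | .inr P, k, p, Q => ∃ Q' : Fin k → S', (∀ i, Q i = .inr (Q' i)) ∧ N.coll P k p Q'

end TransSystem

/-! ### Trees -/

/-- A finitely branching, possibly infinite tree with nodes labelled by states and edges labelled
by reals. A node is given by its address: the root is `[]`, and the children of the node `u` are
`i :: u` for `i < arity u`. The values at lists that are not addresses of nodes are irrelevant. -/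
structure LTree (S : Type v) where
  arity : List ℕ → ℕ
  label : List ℕ → S
  /-- `weight u i` is the label of the edge from `u` to its child `i :: u` -/
  weight : List ℕ → ℕ → ℝ

namespace LTree

variable {S : Type v}

/-- `u` is the address of a node of `t`. -/
def IsNode (t : LTree S) : List ℕ → Prop
  | [] => True
  | i :: u => t.IsNode u ∧ i < t.arity u

def IsLeaf (t : LTree S) (u : List ℕ) : Prop := t.IsNode u ∧ t.arity u = 0

/-- The probability of the path from the root to `u`. -/
def prob (t : LTree S) : List ℕ → ℝ
  | [] => 1
  | i :: u => t.prob u * t.weight u i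

/-- The leaves at depth at most `k`, i.e. the finite branches of length at most `k`. -/
def leavesUpTo (t : LTree S) (k : ℕ) : Set (List ℕ) := {u | t.IsLeaf u ∧ u.length ≤ k}

/-- There are finitely many finite branches of length at most `k`, so that the sum over them
below is an honest finite sum. -/
theorem finite_leavesUpTo (t : LTree S) (k : ℕ) : (t.leavesUpTo k).Finite := by
  have h : {u | t.IsNode u ∧ u.length ≤ k}.Finite := by
    induction k with
    | zero =>
      refine (Set.finite_singleton ([] : List ℕ)).subset ?_
      rintro u ⟨-, hu⟩
      simpa using hu
    | succ k ih =>
      refine ((Set.finite_singleton ([] : List ℕ)).union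
        (ih.biUnion fun u _ => (Set.finite_Iio (t.arity u)).image fun i => i :: u)).subset ?_
      rintro (_ | ⟨i, u⟩) ⟨hn, hl⟩
      · exact Or.inl rfl
      · refine Or.inr (Set.mem_biUnion (x := u) ⟨hn.1, ?_⟩ ⟨i, hn.2, rfl⟩)
        simpa using hl
  exact h.subset fun u hu => ⟨hu.1.1, hu.2⟩

/-- The probability of the finite branches of length at most `k`. -/
noncomputable def convUpTo (t : LTree S) (k : ℕ) : ℝ := ∑ᶠ u ∈ t.leavesUpTo k, t.prob u

/-- The convergence probability of `t` is `1`. -/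
def Regular (t : LTree S) : Prop := Tendsto t.convUpTo atTop (𝓝 1)

/-- The convergence probability of `t` is `0`. -/
def Divergent (t : LTree S) : Prop := Tendsto t.convUpTo atTop (𝓝 0)

end LTree

namespace TransSystem

variable {𝒜 : Type u} {S : Type v}

/-! ### Branching bisimilarity with explicit divergence -/

/-- `t` is an `ε`-tree of `A` with regard to `E`. -/
def IsEpsTree (M : TransSystem 𝒜 S) (E : Setoid S) (A : S) (t : LTree S) : Prop :=
  t.label [] = A ∧ ∀ u, t.IsNode u →
    E A (t.label u) ∧
    (t.arity u = 0 ∨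
      (t.arity u = 1 ∧ M.step (t.label u) (.act .tau) (t.label (0 :: u)) ∧ t.weight u 0 = 1) ∨
      (2 ≤ t.arity u ∧ ∃ p : Fin (t.arity u) → Set.Ioo (0 : ℝ) 1,
        M.coll (t.label u) (t.arity u) p (fun i => t.label ((i : ℕ) :: u)) ∧
        ∀ i : Fin (t.arity u), t.weight u i = p i))

/-- The `ℓ`-transition from `A` to the equivalence class `C` with regard to `E`. -/
def LTrans (M : TransSystem 𝒜 S) (E : Setoid S) (A : S) (l : Act 𝒜) (C : Quotient E) : Prop :=
  (l ≠ .tau ∨ C ≠ Quotient.mk E A) ∧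
  ∃ t, M.IsEpsTree E A t ∧ t.Regular ∧
    ∀ u, t.IsLeaf u → ∃ L', M.step (t.label u) (.act l) L' ∧ Quotient.mk E L' = C

open Classical in
/-- The probability that a collective silent transition with probabilities `p` and targets `Q`
arrives at the equivalence class `C`. -/
noncomputable def arriveProb (E : Setoid S) {k : ℕ} (p : Fin k → Set.Ioo (0 : ℝ) 1)
    (Q : Fin k → S) (C : Quotient E) : ℝ :=
  ∑ i, if Quotient.mk E (Q i) = C then (p i : ℝ) else 0

/-- The `q`-transition from `A` to the equivalence class `C` with regard to `E`: the conditional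
probability of arriving at `C`, given that the class of the leaf is left, is `q`. -/
def QTrans (M : TransSystem 𝒜 S) (E : Setoid S) (A : S) (q : ℝ) (C : Quotient E) : Prop :=
  C ≠ Quotient.mk E A ∧
  ∃ t, M.IsEpsTree E A t ∧ t.Regular ∧
    ∀ u, t.IsLeaf u → ∃ (k : ℕ) (p : Fin k → Set.Ioo (0 : ℝ) 1) (Q : Fin k → S),
      M.coll (t.label u) k p Q ∧
      arriveProb E p Q (Quotient.mk E (t.label u)) < 1 ∧
      arriveProb E p Q C / (1 - arriveProb E p Q (Quotient.mk E (t.label u))) = q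

/-- Branching bisimulations. -/
def IsBranchingBisim (M : TransSystem 𝒜 S) (E : Setoid S) : Prop :=
  ∀ A B, E A B → ∀ C : Quotient E,
    (∀ l, M.LTrans E A l C → M.LTrans E B l C) ∧ (∀ q, M.QTrans E A q C → M.QTrans E B q C)

/-- `A` is divergent with respect to `E`: it has a divergent `ε`-tree. -/
def Diverges (M : TransSystem 𝒜 S) (E : Setoid S) (A : S) : Prop :=
  ∃ t, M.IsEpsTree E A t ∧ t.Divergent

def IsDivPreserving (M : TransSystem 𝒜 S) (E : Setoid S) : Prop :=
  ∀ A B, E A B → (M.Diverges E A ↔ M.Diverges E B)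

/-- Branching bisimulations with explicit divergence. -/
def IsBranchingBisimDiv (M : TransSystem 𝒜 S) (E : Setoid S) : Prop :=
  M.IsBranchingBisim E ∧ M.IsDivPreserving E

/-! ### The algorithm

Procedures take values in `Part`, termination being the claim that the value is defined.
Finite sets are traversed in `for` loops in the order given by a function that lists them. -/

end TransSystem

/-- `scan s` lists the elements of `s` in the order in which a `for` loop visits them. -/
def IsScan {X : Type v} (scan : Set X → List X) : Prop := ∀ s x, x ∈ scan s ↔ x ∈ s

/-- The loop `do body while flag`; `body` transforms the values of the program variables and
returns them together with the flag. -/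
def doWhile {σ : Type v} (body : σ → Part (σ × Bool)) : σ → Part σ :=
  PFun.fix (α := σ) (β := σ)
    fun s => (body s).map fun r => if r.2 then Sum.inr r.1 else Sum.inl r.1

/-- The loop ends with `s'` iff `s'` is the value after one execution of the body and the flag is
false, or the flag is true and the loop ends with `s'` when restarted after this execution. -/
theorem mem_doWhile {σ : Type v} (body : σ → Part (σ × Bool)) (s s' : σ) :
    s' ∈ doWhile body s ↔
      (s', false) ∈ body s ∨ ∃ s₁, (s₁, true) ∈ body s ∧ s' ∈ doWhile body s₁ := by
  refine PFun.mem_fix_iff.trans (or_congr ?_ (exists_congr fun s₁ => and_congr_left fun _ => ?_))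
  · refine (Part.mem_map_iff _).trans ⟨?_, fun h => ⟨_, h, rfl⟩⟩
    rintro ⟨⟨r, _ | _⟩, h, e⟩ <;> simp_all
  · refine (Part.mem_map_iff _).trans ⟨?_, fun h => ⟨_, h, rfl⟩⟩
    rintro ⟨⟨r, _ | _⟩, h, e⟩ <;> simp_all

namespace TransSystem

variable {𝒜 : Type u} {S : Type v}

/-- The largest branching bisimulation contained in `E`, as the join of all of them. -/
def quotient (M : TransSystem 𝒜 S) (E : Setoid S) : Setoid S :=
  sSup {F | M.IsBranchingBisim F ∧ F ≤ E}

/-- The labelled edges arising from state-preserving immediate silent transitions. -/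
def EpsEdge (M : TransSystem 𝒜 S) (E : Setoid S) (B : S) (l : ActP 𝒜) (B' : S) : Prop :=
  (l = .act .tau ∧ M.step B (.act .tau) B' ∧ E B B') ∨
  (∃ (k : ℕ) (p : Fin k → Set.Ioo (0 : ℝ) 1) (Q : Fin k → S),
    M.coll B k p Q ∧ (∀ j, E B (Q j)) ∧ ∃ j, l = .prob (p j) ∧ B' = Q j)

/-- The vertices of the `ε`-graph of `A`. Its edges are the `EpsEdge`s between them. -/
def epsVertices (M : TransSystem 𝒜 S) (E : Setoid S) (A : S) : Set S :=
  {B | Relation.ReflTransGen (fun P Q => ∃ l, M.EpsEdge E P l Q) A B}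

/-- The vertices of out degree `0` of the `ε`-graph of `A`. -/
def epsSinks (M : TransSystem 𝒜 S) (E : Setoid S) (A : S) : Set S :=
  {B | B ∈ M.epsVertices E A ∧ ∀ l B', ¬ M.EpsEdge E B l B'}

/-- The variables of `detDivTree`: the vertices found to be non-divergent, and the undecided ones. -/
structure DetState (S : Type v) where
  ndiv : Set S
  und : Set S

/-- The value of the flag `nonDiv` after the two inner `for` loops over the edges that leave `B`
in the `ε`-graph. -/
def NonDiv (M : TransSystem 𝒜 S) (E : Setoid S) (und : Set S) (B : S) : Prop :=
  (∀ B', M.EpsEdge E B (.act .tau) B' → B' ∉ und) ∧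
  (∀ p B', M.EpsEdge E B (.prob p) B' → ¬ ∀ q B'', M.step B (.prob q) B'' → B'' ∈ und)

open Classical in
/-- The body of the `do … while` loop of `detDivTree`: traverse the undecided vertices and update
the sets in place; the flag `toCon` tells whether some vertex has been moved. -/
noncomputable def detDivBody (M : TransSystem 𝒜 S) (scan : Set S → List S) (E : Setoid S)
    (s : DetState S) : DetState S × Bool :=
  (scan s.und).foldl
    (fun r B => if M.NonDiv E r.1.und B then (⟨r.1.ndiv ∪ {B}, r.1.und \ {B}⟩, true) else r)
    (s, false)

open Classical in
/-- The procedure that checks whether `A` has a divergent `ε`-tree with regard to `E`. -/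
noncomputable def detDivTree (M : TransSystem 𝒜 S) (scan : Set S → List S) (E : Setoid S)
    (A : S) : Part Bool :=
  (doWhile (fun s => Part.some (M.detDivBody scan E s))
    ⟨M.epsSinks E A, M.epsVertices E A \ M.epsSinks E A⟩).map
      fun s => if A ∈ s.ndiv then false else true

/-- The `for` loop of `findDivSplit`. -/
noncomputable def findDivSplitLoop (M : TransSystem 𝒜 S) (scan : Set S → List S) (E : Setoid S) :
    List (S × S) → Part (Option S)
  | [] => Part.some none
  | (P, Q) :: rest =>
    (M.detDivTree scan E P).bind fun isDivP =>
      (M.detDivTree scan E Q).bind fun isDivQ =>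
        if isDivP ≠ isDivQ then Part.some (some P) else M.findDivSplitLoop scan E rest

/-- Search for a divergence splitter of `E`: the value `none` means that there is none, and
`some P` that `P` has been found to be one. -/
noncomputable def findDivSplit (M : TransSystem 𝒜 S) (scan : Set S → List S)
    (scanPairs : Set (S × S) → List (S × S)) (E : Setoid S) : Part (Option S) :=
  M.findDivSplitLoop scan E (scanPairs {x | E x.1 x.2})

/-- The `for` loop of `divRefine`, acting on the pair of sets of divergent and non-divergent
processes found so far. -/
noncomputable def divRefineLoop (M : TransSystem 𝒜 S) (scan : Set S → List S) (E : Setoid S) :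
    List S → Set S × Set S → Part (Set S × Set S)
  | [], C => Part.some C
  | Q :: rest, C =>
    (M.detDivTree scan E Q).bind fun isDiv =>
      M.divRefineLoop scan E rest (if isDiv then (C.1 ∪ {Q}, C.2) else (C.1, C.2 ∪ {Q}))

/-- The equivalence whose classes are the nonempty blocks of a partition `c`. -/
def ofBlocks (c : Set (Set S)) : Setoid S where
  r x y := ∀ b ∈ c, x ∈ b ↔ y ∈ b
  iseqv := ⟨fun _ _ _ => Iff.rfl, fun h b hb => (h b hb).symm,
    fun h h' b hb => (h b hb).trans (h' b hb)⟩

/-- Split the class of `P` into its divergent and its non-divergent members. -/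
noncomputable def divRefine (M : TransSystem 𝒜 S) (scan : Set S → List S) (E : Setoid S) (P : S) :
    Part (Setoid S) :=
  (M.divRefineLoop scan E (scan {Q | E Q P}) (∅, ∅)).map fun C =>
    ofBlocks ((E.classes \ {{Q | E Q P}}) ∪ {C.1, C.2})

/-- The variables of the main procedure: `Eini` and `E`. -/
structure MainState (S : Type v) where
  Eini : Setoid S
  E : Setoid S

/-- The body of the main loop; the flag is `toCon`. -/
noncomputable def mainBody (M : TransSystem 𝒜 S) (scan : Set S → List S)
    (scanPairs : Set (S × S) → List (S × S)) (s : MainState S) : Part (MainState S × Bool) :=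
  (M.findDivSplit scan scanPairs (M.quotient s.Eini)).bind fun
    | none => Part.some (⟨s.Eini, M.quotient s.Eini⟩, false)
    | some P => (M.divRefine scan (M.quotient s.Eini) P).map fun Eref =>
        (⟨Eref, M.quotient s.Eini⟩, true)

/-- The main loop, started with the coarsest partition, and the equivalence `E` it ends with.
The initial value of the variable `E` is never read. -/
noncomputable def mainLoop (M : TransSystem 𝒜 S) (scan : Set S → List S)
    (scanPairs : Set (S × S) → List (S × S)) : Part (Setoid S) :=
  (doWhile (M.mainBody scan scanPairs) ⟨⊤, ⊤⟩).map MainState.E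

end TransSystem

variable {𝒜 : Type u}

/-- Branching bisimilarity with explicit divergence on processes. -/
def BranBisimDiv (A B : Proc 𝒜) : Prop :=
  ∃ E : Setoid (Proc 𝒜), (rccs 𝒜).IsBranchingBisimDiv E ∧ E A B

/-- The disjoint union of the sets of processes reachable from `A` and from `B`. -/
abbrev ReachSum (A B : Proc 𝒜) : Type u := (rccs 𝒜).reach A ⊕ (rccs 𝒜).reach B

/-- The transition system induced on `ReachSum A B`. -/
def reachSystem (A B : Proc 𝒜) : TransSystem 𝒜 (ReachSum A B) :=
  ((rccs 𝒜).restrict ((rccs 𝒜).reach A)).disjUnion ((rccs 𝒜).restrict ((rccs 𝒜).reach B))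

open Classical in
/-- The partition-refinement algorithm. -/
noncomputable def divBranBisim (A B : Proc 𝒜) (scan : Set (ReachSum A B) → List (ReachSum A B))
    (scanPairs : Set (ReachSum A B × ReachSum A B) → List (ReachSum A B × ReachSum A B)) :
    Part Bool :=
  ((reachSystem A B).mainLoop scan scanPairs).map fun E =>
    decide (E (.inl ⟨A, Relation.ReflTransGen.refl⟩) (.inr ⟨B, Relation.ReflTransGen.refl⟩))

end RCCS

/-! Trees can be eliminated. A state has a regular ε-tree with all leaves in a goal set exactly when
it lies in a subset X of its class such that, from every member of X, the goal is reachable by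
silent moves all of whose targets stay in X (`exists_regular_iff`). Indeed, below every node of a
regular tree there is a leaf; conversely, always moving closer to the goal inside a finite X stops
with probability 1. A divergent ε-tree amounts to a trap: a set whose members can each move silently
without leaving it (`diverges_iff`).

Branching bisimulation then becomes a condition on single transitions (`Simulates`). This uses that
a state with a collective transition has no other way to move, so that one exit has to account for
the probabilities of all classes at once. The condition passes to joins (`Simulates.sSup`), hence
`quotient` does yield a branching bisimulation.

The refinement is correct because of `Simulates.diverges_of_le`: if F is a branching bisimulation
with explicit divergence contained in E, then F-equivalent states agree on divergence with respect
to E. Splitting by E-divergence, which `detDivTree` decides by computing the largest trap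
(`detDivTree_eq`), therefore separates no F-equivalent states. So every such F stays below `Eini`,
which shrinks strictly in each round; the loop stops at an equivalence that is itself such a
bisimulation, hence the largest one on R.

Finally, the map from R to processes preserves and reflects transitions. Bisimulations pull back
along it, and the largest one on R is such a pullback (`exists_comap_eq`). R is finite because
everything reachable from a term is an instance of one of its subterms (`derivs_closed`). -/

namespace RCCS

universe u v

/-! ### Convergence probabilities of trees -/

namespace LTree

variable {S : Type v} {t : LTree S}

/-- The probability of reaching a leaf from the node `u` in at most `k` steps. -/
noncomputable def conv (t : LTree S) : ℕ → List ℕ → ℝ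
  | 0, u => if t.arity u = 0 then 1 else 0
  | k + 1, u => if t.arity u = 0 then 1 else
      ∑ i ∈ Finset.range (t.arity u), t.weight u i * conv t k (i :: u)

theorem conv_leaf {u : List ℕ} (h : t.arity u = 0) (k : ℕ) : t.conv k u = 1 := by
  cases k <;> simp [conv, h]

theorem conv_zero {u : List ℕ} (h : t.arity u ≠ 0) : t.conv 0 u = 0 := by
  simp [conv, h]

theorem conv_succ {u : List ℕ} (h : t.arity u ≠ 0) (k : ℕ) :
    t.conv (k + 1) u = ∑ i ∈ Finset.range (t.arity u), t.weight u i * t.conv k (i :: u) := by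
  simp [conv, h]

theorem IsNode.of_append {u : List ℕ} : ∀ {v : List ℕ}, t.IsNode (v ++ u) → t.IsNode u
  | [], h => h
  | _ :: _, h => IsNode.of_append h.1

/-- The leaves that are at most `k` levels below `u`. -/
def leavesBelow (t : LTree S) (k : ℕ) (u : List ℕ) : Set (List ℕ) :=
  {w | t.IsLeaf w ∧ ∃ v, w = v ++ u ∧ v.length ≤ k}

theorem finite_leavesBelow (t : LTree S) (k : ℕ) (u : List ℕ) : (t.leavesBelow k u).Finite := by
  refine (t.finite_leavesUpTo (k + u.length)).subset ?_
  rintro w ⟨hw, v, rfl, hv⟩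
  exact ⟨hw, by simpa using hv⟩

theorem leavesBelow_leaf {u : List ℕ} (hu : t.IsNode u) (h : t.arity u = 0) (k : ℕ) :
    t.leavesBelow k u = {u} := by
  ext w
  constructor
  · rintro ⟨hw, v, rfl, hv⟩
    -- Addresses list the latest step first, so the step taken at `u` is the last entry of `v`.
    rcases List.eq_nil_or_concat v with rfl | ⟨v', i, rfl⟩
    · simp
    · have h1 : t.IsNode (v' ++ i :: u) := by simpa using hw.1
      have h2 := h1.of_append.2
      omega
  · rintro rfl
    exact ⟨⟨hu, h⟩, [], by simp⟩

theorem leavesBelow_zero {u : List ℕ} (h : t.arity u ≠ 0) : t.leavesBelow 0 u = ∅ := by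
  ext w
  simp only [Set.mem_empty_iff_false, iff_false]
  rintro ⟨hw, v, rfl, hv⟩
  obtain rfl : v = [] := by simpa using hv
  exact h hw.2

theorem leavesBelow_succ {u : List ℕ} (h : t.arity u ≠ 0) (k : ℕ) :
    t.leavesBelow (k + 1) u = ⋃ i ∈ (Finset.range (t.arity u) : Set ℕ),
      t.leavesBelow k (i :: u) := by
  ext w
  simp only [Set.mem_iUnion]
  constructor
  · rintro ⟨hw, v, rfl, hv⟩
    rcases List.eq_nil_or_concat v with rfl | ⟨v', i, rfl⟩
    · exact absurd hw.2 h
    · have h1 : t.IsNode (v' ++ i :: u) := by simpa using hw.1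
      exact ⟨i, by simpa using h1.of_append.2, hw, v', by simp, by simpa using hv⟩
  · rintro ⟨i, -, hw, v, rfl, hv⟩
    exact ⟨hw, v ++ [i], by simp, by simpa using hv⟩

/-- The leaves below an inner node are partitioned by the child they pass through. This replaces the
sum over leaves by the one-step recursion of `conv`. -/
theorem finsum_leavesBelow (t : LTree S) (k : ℕ) : ∀ u, t.IsNode u →
    ∑ᶠ w ∈ t.leavesBelow k u, t.prob w = t.prob u * t.conv k u := by
  induction k with
  | zero =>
    intro u hu
    by_cases h : t.arity u = 0
    · rw [leavesBelow_leaf hu h, finsum_mem_singleton, conv_leaf h, mul_one]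
    · rw [leavesBelow_zero h, finsum_mem_empty, conv_zero h, mul_zero]
  | succ k ih =>
    intro u hu
    by_cases h : t.arity u = 0
    · rw [leavesBelow_leaf hu h, finsum_mem_singleton, conv_leaf h, mul_one]
    · rw [leavesBelow_succ h, finsum_mem_biUnion ?_ (Finset.finite_toSet _)
        (fun i _ => t.finite_leavesBelow k _), finsum_mem_coe_finset, conv_succ h, Finset.mul_sum]
      · refine Finset.sum_congr rfl fun i hi => ?_
        rw [ih (i :: u) ⟨hu, Finset.mem_range.1 hi⟩, prob, mul_assoc]
      · intro i _ j _ hij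
        refine Set.disjoint_left.2 ?_
        rintro w ⟨-, v, rfl, -⟩ ⟨-, v', hv', -⟩
        have h1 : v ++ [i] ++ u = v' ++ [j] ++ u := by simpa using hv'
        have h2 := List.append_cancel_right h1
        exact hij (by simpa using (List.append_inj' h2 rfl).2)

theorem convUpTo_eq (t : LTree S) (k : ℕ) : t.convUpTo k = t.conv k [] := by
  have h := t.finsum_leavesBelow k [] trivial
  rw [prob, one_mul] at h
  rw [← h, convUpTo]
  suffices t.leavesUpTo k = t.leavesBelow k [] by rw [this]
  ext w
  constructor
  · rintro ⟨h1, h2⟩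
    exact ⟨h1, w, by simp, h2⟩
  · rintro ⟨h1, v, rfl, h2⟩
    exact ⟨h1, by simpa using h2⟩

/-- The edges that leave an inner node are labelled by a distribution with full support. -/
def Stochastic (t : LTree S) : Prop := ∀ u, t.IsNode u → t.arity u ≠ 0 →
  (∀ i < t.arity u, 0 < t.weight u i) ∧ ∑ i ∈ Finset.range (t.arity u), t.weight u i = 1

theorem Stochastic.conv_mem (ht : t.Stochastic) (k : ℕ) :
    ∀ u, t.IsNode u → 0 ≤ t.conv k u ∧ t.conv k u ≤ 1 ∧ t.conv k u ≤ t.conv (k + 1) u := by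
  induction k with
  | zero =>
    intro u hu
    by_cases h : t.arity u = 0
    · simp [conv_leaf h]
    · rw [conv_zero h, conv_succ h]
      refine ⟨le_rfl, zero_le_one, Finset.sum_nonneg fun i hi => ?_⟩
      have hw := (ht u hu h).1 i (Finset.mem_range.1 hi)
      refine mul_nonneg hw.le ?_
      unfold conv
      split_ifs <;> norm_num
  | succ k ih =>
    intro u hu
    by_cases h : t.arity u = 0
    · simp [conv_leaf h]
    · obtain ⟨hw, hs⟩ := ht u hu h
      have hI : ∀ i ∈ Finset.range (t.arity u), 0 ≤ t.weight u i ∧ t.IsNode (i :: u) :=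
        fun i hi => ⟨(hw i (Finset.mem_range.1 hi)).le, hu, Finset.mem_range.1 hi⟩
      rw [conv_succ h, conv_succ h]
      refine ⟨Finset.sum_nonneg fun i hi => mul_nonneg (hI i hi).1 (ih _ (hI i hi).2).1, ?_,
        Finset.sum_le_sum fun i hi =>
          mul_le_mul_of_nonneg_left (ih _ (hI i hi).2).2.2 (hI i hi).1⟩
      rw [← hs]
      exact Finset.sum_le_sum fun i hi => mul_le_of_le_one_right (hI i hi).1 (ih _ (hI i hi).2).2.1

theorem Stochastic.monotone_conv (ht : t.Stochastic) {u : List ℕ} (hu : t.IsNode u) :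
    Monotone fun k => t.conv k u :=
  monotone_nat_of_le_succ fun k => (ht.conv_mem k u hu).2.2

theorem exists_leaf_of_conv_ne_zero (k : ℕ) :
    ∀ u, t.IsNode u → t.conv k u ≠ 0 → ∃ v, t.IsLeaf (v ++ u) := by
  induction k with
  | zero =>
    intro u hu h
    by_cases h0 : t.arity u = 0
    · exact ⟨[], hu, h0⟩
    · exact absurd (conv_zero h0) h
  | succ k ih =>
    intro u hu h
    by_cases h0 : t.arity u = 0
    · exact ⟨[], hu, h0⟩
    · rw [conv_succ h0] at h
      obtain ⟨i, hi, hne⟩ := Finset.exists_ne_zero_of_sum_ne_zero h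
      obtain ⟨v, hv⟩ := ih (i :: u) ⟨hu, Finset.mem_range.1 hi⟩ (right_ne_zero_of_mul hne)
      exact ⟨v ++ [i], by simpa using hv⟩

/-- Regularity is inherited by subtrees: the deficit `1 - conv` of a node is the weighted sum of the
deficits of its children, so a child's deficit is at most that of its parent divided by the positive
weight of the edge. -/
theorem Stochastic.tendsto_conv (ht : t.Stochastic) (hr : t.Regular) :
    ∀ u, t.IsNode u → Tendsto (fun k => t.conv k u) atTop (𝓝 1)
  | [], _ => by simpa only [Regular, funext t.convUpTo_eq] using hr
  | i :: u, hn => by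
    have ih := ht.tendsto_conv hr u hn.1
    have h0 : t.arity u ≠ 0 := by have := hn.2; omega
    obtain ⟨hw, hs⟩ := ht u hn.1 h0
    have hwi := hw i hn.2
    have key : ∀ k, 1 - (1 - t.conv (k + 1) u) / t.weight u i ≤ t.conv k (i :: u) := by
      intro k
      rw [sub_le_comm, le_div_iff₀ hwi]
      have h1 : 1 - t.conv (k + 1) u = ∑ j ∈ Finset.range (t.arity u),
          t.weight u j * (1 - t.conv k (j :: u)) := by
        simp only [mul_sub, mul_one, Finset.sum_sub_distrib, hs, conv_succ h0]
      rw [h1, mul_comm]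
      refine Finset.single_le_sum
        (f := fun j => t.weight u j * (1 - t.conv k (j :: u))) (fun j hj => ?_)
        (Finset.mem_range.2 hn.2)
      have hj := Finset.mem_range.1 hj
      exact mul_nonneg (hw j hj).le (sub_nonneg.2 (ht.conv_mem k (j :: u) ⟨hn.1, hj⟩).2.1)
    refine tendsto_of_tendsto_of_tendsto_of_le_of_le ?_ tendsto_const_nhds key
      fun k => (ht.conv_mem k _ hn).2.1
    have h2 := (tendsto_add_atTop_iff_nat 1).2 ih
    simpa using ((h2.const_sub 1).div_const (t.weight u i)).const_sub 1

theorem Stochastic.exists_leaf (ht : t.Stochastic) (hr : t.Regular) {u : List ℕ}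
    (hu : t.IsNode u) : ∃ v, t.IsLeaf (v ++ u) := by
  have h := (ht.tendsto_conv hr u hu).eventually_ne one_ne_zero
  obtain ⟨k, hk⟩ := h.exists
  exact exists_leaf_of_conv_ne_zero k u hu hk

/-- A vanishing sum of nonnegative terms with positive weights forces each child to have value zero;
so a divergent tree has no leaves. -/
theorem Stochastic.conv_eq_zero (ht : t.Stochastic) (hd : t.Divergent) :
    ∀ u, t.IsNode u → ∀ k, t.conv k u = 0
  | [], hn, k => by
    have hd : Tendsto (fun k => t.conv k []) atTop (𝓝 0) := by
      simpa only [Divergent, funext t.convUpTo_eq] using hd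
    exact le_antisymm ((ht.monotone_conv hn).ge_of_tendsto hd k) (ht.conv_mem k _ hn).1
  | i :: u, hn, k => by
    have ih := ht.conv_eq_zero hd u hn.1 (k + 1)
    have h0 : t.arity u ≠ 0 := by have := hn.2; omega
    obtain ⟨hw, -⟩ := ht u hn.1 h0
    rw [conv_succ h0, Finset.sum_eq_zero_iff_of_nonneg fun j hj => ?_] at ih
    · exact (mul_eq_zero.1 (ih i (Finset.mem_range.2 hn.2))).resolve_left (hw i hn.2).ne'
    · have hj := Finset.mem_range.1 hj
      exact mul_nonneg (hw j hj).le (ht.conv_mem k (j :: u) ⟨hn.1, hj⟩).1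

theorem Stochastic.arity_ne_zero (ht : t.Stochastic) (hd : t.Divergent) {u : List ℕ}
    (hu : t.IsNode u) : t.arity u ≠ 0 := fun h => by
  have := ht.conv_eq_zero hd u hu 0
  rw [conv_leaf h] at this
  exact one_ne_zero this

theorem divergent_of_arity_ne_zero (h : ∀ u, t.IsNode u → t.arity u ≠ 0) : t.Divergent := by
  have h0 : ∀ k, t.convUpTo k = 0 := fun k => by
    have : t.leavesUpTo k = ∅ := by
      ext u
      simp only [Set.mem_empty_iff_false, iff_false]
      exact fun hu => h u hu.1.1 hu.1.2
    rw [convUpTo, this, finsum_mem_empty]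
  rw [Divergent, show t.convUpTo = fun _ => 0 from funext h0]
  exact tendsto_const_nhds

/-! ### Trees given by a memoryless strategy -/

/-- Node labels of the tree that unfolds the successor function `nxt` from `A`. -/
def unfoldLabel (nxt : S → ℕ → S) (A : S) : List ℕ → S
  | [] => A
  | i :: u => nxt (unfoldLabel nxt A u) i

/-- The tree with root `A` in which arity, children and weights depend only on the label. -/
def unfold (n : S → ℕ) (nxt : S → ℕ → S) (w : S → ℕ → ℝ) (A : S) : LTree S where
  arity u := n (unfoldLabel nxt A u)
  label := unfoldLabel nxt A
  weight u := w (unfoldLabel nxt A u)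

section unfold

variable {n : S → ℕ} {nxt : S → ℕ → S} {w : S → ℕ → ℝ} {X : Set S}

theorem unfold_label_mem (hX : ∀ B ∈ X, ∀ i < n B, nxt B i ∈ X) {A : S} (hA : A ∈ X) :
    ∀ u, (unfold n nxt w A).IsNode u → (unfold n nxt w A).label u ∈ X
  | [], _ => hA
  | _ :: u, h => hX _ (unfold_label_mem hX hA u h.1) _ h.2

/-- The subtree at the `i`-th child of the root is the unfolding from `nxt A i`. The first step sits
at the end of an address, hence `u ++ [i]`. -/
theorem unfold_conv_cons (A : S) (i : ℕ) (k : ℕ) :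
    ∀ u, (unfold n nxt w A).conv k (u ++ [i]) = (unfold n nxt w (nxt A i)).conv k u := by
  have hl : ∀ u, unfoldLabel nxt A (u ++ [i]) = unfoldLabel nxt (nxt A i) u := by
    intro u
    induction u with
    | nil => rfl
    | cons j u ih => simp [unfoldLabel, ih]
  have ha : ∀ u, (unfold n nxt w A).arity (u ++ [i]) = (unfold n nxt w (nxt A i)).arity u :=
    fun u => congrArg n (hl u)
  have hw : ∀ u, (unfold n nxt w A).weight (u ++ [i]) = (unfold n nxt w (nxt A i)).weight u :=
    fun u => congrArg w (hl u)
  induction k with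
  | zero => intro u; simp [conv, ha]
  | succ k ih =>
    intro u
    have h2 : ∀ j, (unfold n nxt w A).conv k (j :: (u ++ [i])) =
        (unfold n nxt w (nxt A i)).conv k (j :: u) := fun j => ih (j :: u)
    simp [conv, ha, hw, h2]

/-- If the strategy never leaves the finite set `X` and, from every state, a state in which it stops
can be reached, as witnessed by the decreasing `rank`, then it stops almost surely. -/
theorem unfold_regular (hfin : X.Finite) (hX : ∀ B ∈ X, ∀ i < n B, nxt B i ∈ X)
    (hw : ∀ B ∈ X, n B ≠ 0 → (∀ i < n B, 0 < w B i) ∧ ∑ i ∈ Finset.range (n B), w B i = 1)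
    (rank : S → ℕ) (hr : ∀ B ∈ X, n B ≠ 0 → ∃ i < n B, rank (nxt B i) < rank B)
    {A : S} (hA : A ∈ X) : (unfold n nxt w A).Regular := by
  have hst : ∀ B ∈ X, (unfold n nxt w B).Stochastic := fun B hB u hu h =>
    hw _ (unfold_label_mem hX hB u hu) h
  have hlim : ∀ B ∈ X, ∃ h, Tendsto (fun k => (unfold n nxt w B).conv k []) atTop (𝓝 h) :=
    fun B hB => ⟨_, tendsto_atTop_ciSup ((hst B hB).monotone_conv trivial)
      ⟨1, by rintro _ ⟨k, rfl⟩; exact ((hst B hB).conv_mem k [] trivial).2.1⟩⟩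
  classical
  -- `h B` is the probability of ever stopping when started in `B`. It is 1 where the strategy stops
  -- and harmonic elsewhere.
  choose! h hh using hlim
  have hleaf : ∀ B ∈ X, n B = 0 → h B = 1 := fun B hB h0 =>
    tendsto_nhds_unique (hh B hB) (by
      simp only [conv_leaf (t := unfold n nxt w B) (u := []) h0]
      exact tendsto_const_nhds)
  have hharm : ∀ B ∈ X, n B ≠ 0 → h B = ∑ i ∈ Finset.range (n B), w B i * h (nxt B i) := by
    intro B hB h0
    refine tendsto_nhds_unique ((tendsto_add_atTop_iff_nat 1).2 (hh B hB)) ?_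
    have h1 : ∀ k, (unfold n nxt w B).conv (k + 1) [] =
        ∑ i ∈ Finset.range (n B), w B i * (unfold n nxt w (nxt B i)).conv k [] := by
      intro k
      rw [conv_succ (t := unfold n nxt w B) (u := []) h0]
      exact Finset.sum_congr rfl fun i _ => congrArg _ (unfold_conv_cons B i k [])
    simp only [h1]
    exact tendsto_finsetSum _ fun i hi =>
      (hh _ (hX B hB i (Finset.mem_range.1 hi))).const_mul _
  -- Minimum principle: where `h` attains its minimum, so do all successors. Following decreasing
  -- `rank` carries the minimum to a stopping state, where `h` is 1.
  obtain ⟨B₀, hB₀, hmin⟩ := hfin.exists_minimalFor h X ⟨A, hA⟩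
  have hmin : ∀ B ∈ X, h B₀ ≤ h B := fun B hB =>
    (le_total (h B₀) (h B)).elim id fun hle => hmin hB hle
  have hone : ∀ r, ∀ B ∈ X, rank B = r → h B = h B₀ → h B₀ = 1 := by
    intro r
    induction r using Nat.strong_induction_on with
    | _ r ih =>
      intro B hB hBr hBm
      by_cases h0 : n B = 0
      · rw [← hBm, hleaf B hB h0]
      obtain ⟨i, hi, hri⟩ := hr B hB h0
      obtain ⟨hpos, hsum⟩ := hw B hB h0
      refine ih _ (hBr ▸ hri) _ (hX B hB i hi) rfl ?_
      have h1 : ∑ j ∈ Finset.range (n B), w B j * (h (nxt B j) - h B₀) = 0 := by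
        simp only [mul_sub, Finset.sum_sub_distrib, ← Finset.sum_mul, hsum, one_mul,
          ← hharm B hB h0, hBm, sub_self]
      rw [Finset.sum_eq_zero_iff_of_nonneg fun j hj => ?_] at h1
      · exact sub_eq_zero.1 ((mul_eq_zero.1 (h1 i (Finset.mem_range.2 hi))).resolve_left
          (hpos i hi).ne')
      · have hj := Finset.mem_range.1 hj
        exact mul_nonneg (hpos j hj).le (sub_nonneg.2 (hmin _ (hX B hB j hj)))
  have h1 : h A = 1 := le_antisymm
    (le_of_tendsto' (hh A hA) fun k => ((hst A hA).conv_mem k [] trivial).2.1)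
    (hone _ B₀ hB₀ rfl rfl ▸ hmin A hA)
  simpa only [Regular, funext (convUpTo_eq _), ← h1] using hh A hA

end unfold

end LTree

/-! ### Almost sure reachability in alternating systems -/

namespace TransSystem

variable {𝒜 : Type u} {S : Type v} {M : TransSystem 𝒜 S}

/-- The properties of the transition system of processes on which the algorithm relies: a state has
at most one collective silent transition, and no other transitions besides it. -/
structure IsAlternating (M : TransSystem 𝒜 S) : Prop where
  two_le : ∀ {A k p Q}, M.coll A k p Q → 2 ≤ k
  sum_eq : ∀ {A k p Q}, M.coll A k p Q → ∑ i, (p i : ℝ) = 1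
  unique : ∀ {A k p Q k' p' Q'}, M.coll A k p Q → M.coll A k' p' Q' →
    (⟨k, p, Q⟩ : Σ k, (Fin k → Set.Ioo (0 : ℝ) 1) × (Fin k → S)) = ⟨k', p', Q'⟩
  not_act : ∀ {A k p Q α B}, M.coll A k p Q → ¬ M.step A (.act α) B
  step_prob : ∀ {A k p Q q B}, M.coll A k p Q → (M.step A (.prob q) B ↔ ∃ j, q = p j ∧ B = Q j)
  finite_reach : ∀ A, (M.reach A).Finite

/-- `M.Leads X G n B`: from `B` some state that satisfies `G` can be reached in `n` immediate silent
transitions all targets of which are in `X`. -/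
inductive Leads (M : TransSystem 𝒜 S) (X : Set S) (G : S → Prop) : ℕ → S → Prop
  | here {B : S} : B ∈ X → G B → Leads M X G 0 B
  | tau {n : ℕ} {B B' : S} : B ∈ X → M.step B (.act .tau) B' → Leads M X G n B' →
      Leads M X G (n + 1) B
  | coll {n k : ℕ} {B : S} {p : Fin k → Set.Ioo (0 : ℝ) 1} {Q : Fin k → S} (j : Fin k) : B ∈ X →
      M.coll B k p Q → (∀ i, Q i ∈ X) → Leads M X G n (Q j) → Leads M X G (n + 1) B

theorem Leads.mem {X : Set S} {G : S → Prop} {n : ℕ} {B : S} (h : M.Leads X G n B) : B ∈ X := by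
  cases h <;> assumption

theorem Leads.bind {X X' : Set S} {G G' : S → Prop} (hX : X ⊆ X') {n : ℕ} {B : S}
    (h : M.Leads X G n B) (hG : ∀ L ∈ X, G L → ∃ n, M.Leads X' G' n L) :
    ∃ n, M.Leads X' G' n B := by
  induction h with
  | here hB h => exact hG _ hB h
  | tau hB hs _ ih => exact ih.imp' _ fun _ h => .tau (hX hB) hs h
  | coll j hB hc hQ _ ih => exact ih.imp' _ fun _ h => .coll j (hX hB) hc (fun i => hX (hQ i)) h

theorem Leads.exists_goal {X : Set S} {G : S → Prop} {n : ℕ} {B : S} (h : M.Leads X G n B) :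
    ∃ L ∈ X, G L := by
  induction h with
  | here hB h => exact ⟨_, hB, h⟩
  | tau _ _ _ ih => exact ih
  | coll _ _ _ _ _ ih => exact ih

/-- By immediate silent transitions inside the class of `A` one can almost surely get from `A` to a
state that satisfies `G`. -/
def AlmostSure (M : TransSystem 𝒜 S) (E : Setoid S) (A : S) (G : S → Prop) : Prop :=
  ∃ X : Set S, A ∈ X ∧ (∀ B ∈ X, E A B) ∧ ∀ B ∈ X, ∃ n, M.Leads X G n B

theorem AlmostSure.of_goal {E : Setoid S} {A : S} {G : S → Prop} (h : G A) : M.AlmostSure E A G :=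
  ⟨{A}, rfl, by rintro B rfl; exact E.refl _, by rintro B rfl; exact ⟨0, .here rfl h⟩⟩

theorem AlmostSure.mono {E : Setoid S} {A : S} {G G' : S → Prop} (h : M.AlmostSure E A G)
    (hG : ∀ L, E A L → G L → G' L) : M.AlmostSure E A G' := by
  obtain ⟨X, hA, hE, hX⟩ := h
  refine ⟨X, hA, hE, fun B hB => ?_⟩
  obtain ⟨n, hn⟩ := hX B hB
  exact hn.bind subset_rfl fun L hL h => ⟨0, .here hL (hG L (hE L hL) h)⟩

theorem AlmostSure.exists_goal {E : Setoid S} {A : S} {G : S → Prop} (h : M.AlmostSure E A G) :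
    ∃ L, E A L ∧ G L := by
  obtain ⟨X, hA, hE, hX⟩ := h
  obtain ⟨n, hn⟩ := hX A hA
  obtain ⟨L, hL, hG⟩ := hn.exists_goal
  exact ⟨L, hE L hL, hG⟩

theorem step_of_coll (hM : M.IsAlternating) {A : S} {k : ℕ} {p : Fin k → Set.Ioo (0 : ℝ) 1}
    {Q : Fin k → S} (h : M.coll A k p Q) (j : Fin k) : M.step A (.prob (p j)) (Q j) :=
  (hM.step_prob h).2 ⟨j, rfl, rfl⟩

/-! ### Regular trees -/

theorem IsEpsTree.stochastic (hM : M.IsAlternating) {E : Setoid S} {A : S} {t : LTree S}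
    (ht : M.IsEpsTree E A t) : t.Stochastic := by
  intro u hu h0
  obtain ⟨-, h | ⟨h1, -, hw⟩ | ⟨-, p, hc, hw⟩⟩ := ht.2 u hu
  · exact absurd h h0
  · rw [h1]
    refine ⟨fun i hi => ?_, by simpa using hw⟩
    obtain rfl : i = 0 := by omega
    rw [hw]
    exact one_pos
  · refine ⟨fun i hi => (hw ⟨i, hi⟩).symm ▸ (p ⟨i, hi⟩).2.1, ?_⟩
    rw [Finset.sum_range, ← hM.sum_eq hc]
    exact Finset.sum_congr rfl fun i _ => hw i

/-- The labels occurring in the tree serve as `X`: a regular tree has a leaf below each node, and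
the path to it stays among the labels. -/
theorem IsEpsTree.almostSure (hM : M.IsAlternating) {E : Setoid S} {A : S} {t : LTree S}
    (ht : M.IsEpsTree E A t) (hr : t.Regular) {G : S → Prop}
    (hG : ∀ u, t.IsLeaf u → G (t.label u)) : M.AlmostSure E A G := by
  refine ⟨{B | ∃ u, t.IsNode u ∧ t.label u = B}, ⟨[], trivial, ht.1⟩, ?_, ?_⟩
  · rintro _ ⟨u, hu, rfl⟩
    exact (ht.2 u hu).1
  · rintro _ ⟨u, hu, rfl⟩
    obtain ⟨v, hv⟩ := (ht.stochastic hM).exists_leaf hr hu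
    clear hu
    induction v using List.reverseRecOn generalizing u with
    | nil => exact ⟨0, .here ⟨u, hv.1, rfl⟩ (hG _ hv)⟩
    | append_singleton v i ih =>
      have hv : t.IsLeaf (v ++ i :: u) := by simpa using hv
      obtain ⟨n, hn⟩ := ih (i :: u) hv
      have hi := hv.1.of_append
      obtain ⟨-, h | ⟨h1, hs, -⟩ | ⟨-, p, hc, -⟩⟩ := ht.2 u hi.1
      · have := hi.2
        omega
      · obtain rfl : i = 0 := by have := hi.2; omega
        exact ⟨n + 1, .tau ⟨u, hi.1, rfl⟩ hs hn⟩
      · exact ⟨n + 1, .coll ⟨i, hi.2⟩ ⟨u, hi.1, rfl⟩ hc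
          (fun j => ⟨(j : ℕ) :: u, ⟨hi.1, j.2⟩, rfl⟩) hn⟩

/-- `n`, `nxt`, `w` describe the arity, the targets and the weights of an immediate silent
transition of `B` into `X`. -/
def IsMove (M : TransSystem 𝒜 S) (X : Set S) (B : S) (n : ℕ) (nxt : ℕ → S) (w : ℕ → ℝ) : Prop :=
  (∀ i < n, nxt i ∈ X) ∧
  ((n = 1 ∧ M.step B (.act .tau) (nxt 0) ∧ w 0 = 1) ∨
    (2 ≤ n ∧ ∃ p : Fin n → Set.Ioo (0 : ℝ) 1, M.coll B n p (fun i => nxt i) ∧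
      ∀ i : Fin n, w i = p i))

theorem isMove_tau {X : Set S} {B B' : S} (h : M.step B (.act .tau) B') (hX : B' ∈ X) :
    M.IsMove X B 1 (fun _ => B') (fun _ => 1) :=
  ⟨fun _ _ => hX, Or.inl ⟨rfl, h, rfl⟩⟩

/-- The values `B` and `0` beyond index `k` only make the functions total. -/
theorem isMove_coll (hM : M.IsAlternating) {X : Set S} {B : S} {k : ℕ}
    {p : Fin k → Set.Ioo (0 : ℝ) 1} {Q : Fin k → S} (h : M.coll B k p Q) (hX : ∀ i, Q i ∈ X) :
    M.IsMove X B k (fun i => if h : i < k then Q ⟨i, h⟩ else B)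
      (fun i => if h : i < k then p ⟨i, h⟩ else 0) :=
  ⟨fun i hi => by simpa [hi] using hX _, Or.inr ⟨hM.two_le h, p, by simpa using h, by simp⟩⟩

theorem isEpsTree_unfold {E : Setoid S} {X : Set S} {A : S} (hA : A ∈ X) (hE : ∀ B ∈ X, E A B)
    {n : S → ℕ} {nxt : S → ℕ → S} {w : S → ℕ → ℝ}
    (hmv : ∀ B ∈ X, n B = 0 ∨ M.IsMove X B (n B) (nxt B) (w B)) :
    M.IsEpsTree E A (LTree.unfold n nxt w A) := by
  refine ⟨rfl, fun u hu => ?_⟩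
  have hX : LTree.unfoldLabel nxt A u ∈ X := LTree.unfold_label_mem (n := n) (w := w)
    (fun B hB i hi => ?_) hA u hu
  · refine ⟨hE _ hX, (hmv _ hX).imp id fun h => h.2⟩
  · rcases hmv B hB with h | h
    · omega
    · exact h.1 i hi

theorem IsMove.stochastic (hM : M.IsAlternating) {X : Set S} {B : S} {n : ℕ} {nxt : ℕ → S}
    {w : ℕ → ℝ} (h : M.IsMove X B n nxt w) :
    (∀ i < n, 0 < w i) ∧ ∑ i ∈ Finset.range n, w i = 1 := by
  obtain ⟨-, ⟨rfl, -, hw⟩ | ⟨-, p, hc, hw⟩⟩ := h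
  · refine ⟨fun i hi => ?_, by simpa using hw⟩
    obtain rfl : i = 0 := by omega
    rw [hw]
    exact one_pos
  · refine ⟨fun i hi => (hw ⟨i, hi⟩).symm ▸ (p ⟨i, hi⟩).2.1, ?_⟩
    rw [Finset.sum_range, ← hM.sum_eq hc]
    exact Finset.sum_congr rfl fun i _ => hw i

theorem Leads.inter_reach (hM : M.IsAlternating) {X : Set S} {A : S} {G : S → Prop} {n : ℕ}
    {B : S} (h : M.Leads X G n B) (hB : B ∈ M.reach A) : M.Leads (X ∩ M.reach A) G n B := by
  induction h with
  | here hX h => exact .here ⟨hX, hB⟩ h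
  | tau hX hs _ ih => exact .tau ⟨hX, hB⟩ hs (ih (.tail hB ⟨_, hs⟩))
  | coll j hX hc hQ _ ih =>
    have hr : ∀ i, _ := fun i => Relation.ReflTransGen.tail hB ⟨_, step_of_coll hM hc i⟩
    exact .coll j ⟨hX, hB⟩ hc (fun i => ⟨hQ i, hr i⟩) (ih (hr j))

/-- The strategy stops where the distance to the goal inside `X` is zero and otherwise makes a move
with some target at smaller distance. `unfold_regular` then applies, once `X` has been cut down to a
finite set. -/
theorem AlmostSure.exists_regular (hM : M.IsAlternating) {E : Setoid S} {A : S} {G : S → Prop}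
    (h : M.AlmostSure E A G) :
    ∃ t, M.IsEpsTree E A t ∧ t.Regular ∧ ∀ u, t.IsLeaf u → G (t.label u) := by
  classical
  obtain ⟨X₀, hA₀, hE₀, hX₀⟩ := h
  -- Intersecting with the finite set of reachable states loses no moves.
  obtain ⟨X, hfin, hA, hE, hX⟩ : ∃ X : Set S, X.Finite ∧ A ∈ X ∧ (∀ B ∈ X, E A B) ∧
      ∀ B ∈ X, ∃ n, M.Leads X G n B :=
    ⟨X₀ ∩ M.reach A, (hM.finite_reach A).subset Set.inter_subset_right, ⟨hA₀, .refl⟩,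
      fun B hB => hE₀ B hB.1, fun B hB => (hX₀ B hB.1).imp fun _ h => h.inter_reach hM hB.2⟩
  let rank : S → ℕ := fun B => if h : ∃ n, M.Leads X G n B then Nat.find h else 0
  have hrank : ∀ B n, M.Leads X G n B → rank B ≤ n := fun B n h => by
    simp only [rank, dif_pos (⟨n, h⟩ : ∃ n, M.Leads X G n B)]
    exact Nat.find_min' _ h
  have hmv : ∀ B ∈ X, ∃ (n : ℕ) (nxt : ℕ → S) (w : ℕ → ℝ), (n = 0 ∧ G B) ∨
      (M.IsMove X B n nxt w ∧ ∃ i < n, rank (nxt i) < rank B) := by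
    intro B hB
    have hB' := hX B hB
    -- A derivation of minimal length either ends at once, in a goal state, or shows the move that
    -- lowers the rank.
    have hl : M.Leads X G (rank B) B := by
      simp only [rank, dif_pos hB']
      exact Nat.find_spec hB'
    generalize hr : rank B = r at hl
    cases hl with
    | here _ h => exact ⟨0, fun _ => B, fun _ => 0, Or.inl ⟨rfl, h⟩⟩
    | tau _ hs h =>
      exact ⟨_, _, _, Or.inr ⟨isMove_tau hs h.mem, 0, one_pos, by
        have := hrank _ _ h; omega⟩⟩
    | coll j _ hc hQ h =>
      refine ⟨_, _, _, Or.inr ⟨isMove_coll hM hc hQ, j, j.2, ?_⟩⟩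
      simpa using Nat.lt_succ_of_le (hrank _ _ h)
  choose! n nxt w hmv using hmv
  have hmv' : ∀ B ∈ X, n B = 0 ∨ M.IsMove X B (n B) (nxt B) (w B) := fun B hB =>
    (hmv B hB).imp And.left And.left
  have hstay : ∀ B ∈ X, ∀ i < n B, nxt B i ∈ X := fun B hB i hi => by
    rcases hmv' B hB with h | h
    · omega
    · exact h.1 i hi
  refine ⟨_, isEpsTree_unfold hA hE hmv', LTree.unfold_regular hfin hstay (fun B hB h0 => ?_) rank
    (fun B hB h0 => ?_) hA, fun u hu => ?_⟩
  · exact ((hmv' B hB).resolve_left h0).stochastic hM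
  · rcases hmv B hB with h | h
    · exact absurd h.1 h0
    · exact h.2
  · rcases hmv _ (LTree.unfold_label_mem hstay hA u hu.1) with h | h
    · exact h.2
    · obtain ⟨i, hi, -⟩ := h.2
      exact absurd hu.2 (Nat.zero_lt_of_lt hi).ne'

theorem exists_regular_iff (hM : M.IsAlternating) {E : Setoid S} {A : S} {G : S → Prop} :
    (∃ t, M.IsEpsTree E A t ∧ t.Regular ∧ ∀ u, t.IsLeaf u → G (t.label u)) ↔
      M.AlmostSure E A G :=
  ⟨fun ⟨_, ht, hr, hG⟩ => ht.almostSure hM hr hG, fun h => h.exists_regular hM⟩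

/-! ### Divergent trees -/

/-- Every state in `U` has an immediate silent transition all targets of which are in `U`. -/
def IsTrap (M : TransSystem 𝒜 S) (U : Set S) : Prop :=
  ∀ B ∈ U, (∃ B' ∈ U, M.step B (.act .tau) B') ∨
    ∃ (k : ℕ) (p : Fin k → Set.Ioo (0 : ℝ) 1) (Q : Fin k → S), M.coll B k p Q ∧ ∀ i, Q i ∈ U

/-- The labels of a divergent tree form a trap, since no node is a leaf. Conversely, choosing one
move inside the trap at each state unfolds to a tree without leaves. -/
theorem diverges_iff (hM : M.IsAlternating) {E : Setoid S} {A : S} :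
    M.Diverges E A ↔ ∃ U : Set S, A ∈ U ∧ (∀ B ∈ U, E A B) ∧ M.IsTrap U := by
  constructor
  · rintro ⟨t, ht, hd⟩
    refine ⟨{B | ∃ u, t.IsNode u ∧ t.label u = B}, ⟨[], trivial, ht.1⟩, ?_, ?_⟩
    · rintro _ ⟨u, hu, rfl⟩
      exact (ht.2 u hu).1
    · rintro _ ⟨u, hu, rfl⟩
      obtain ⟨-, h | ⟨h1, hs, -⟩ | ⟨-, p, hc, -⟩⟩ := ht.2 u hu
      · exact absurd h ((ht.stochastic hM).arity_ne_zero hd hu)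
      · exact Or.inl ⟨_, ⟨0 :: u, ⟨hu, by omega⟩, rfl⟩, hs⟩
      · exact Or.inr ⟨_, p, _, hc, fun i => ⟨(i : ℕ) :: u, ⟨hu, i.2⟩, rfl⟩⟩
  · rintro ⟨U, hA, hE, hU⟩
    have hmv : ∀ B ∈ U, ∃ (n : ℕ) (nxt : ℕ → S) (w : ℕ → ℝ), M.IsMove U B n nxt w := by
      intro B hB
      rcases hU B hB with ⟨B', hB', hs⟩ | ⟨k, p, Q, hc, hQ⟩
      · exact ⟨_, _, _, isMove_tau hs hB'⟩
      · exact ⟨_, _, _, isMove_coll hM hc hQ⟩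
    have : Nonempty S := ⟨A⟩
    choose! n nxt w hmv using hmv
    refine ⟨_, isEpsTree_unfold hA hE fun B hB => Or.inr (hmv B hB),
      LTree.divergent_of_arity_ne_zero fun u hu => ?_⟩
    have := (hmv _ (LTree.unfold_label_mem (fun B hB => (hmv B hB).1) hA u hu)).2
    change n _ ≠ 0
    rcases this with h | h
    · exact h.1 ▸ one_ne_zero
    · exact (two_pos.trans_le h.1).ne'

end TransSystem

/-! ### Exit distributions of collective transitions -/

open Classical in
/-- The probability of arriving at the set `D`. -/
noncomputable def mass {S : Type v} {k : ℕ} (p : Fin k → Set.Ioo (0 : ℝ) 1) (Q : Fin k → S)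
    (D : Set S) : ℝ :=
  ∑ i, if Q i ∈ D then (p i : ℝ) else 0

section mass

variable {S : Type v} {k : ℕ} {p : Fin k → Set.Ioo (0 : ℝ) 1} {Q : Fin k → S}

theorem mass_nonneg (D : Set S) : 0 ≤ mass p Q D := by
  refine Finset.sum_nonneg fun i _ => ?_
  split_ifs
  · exact (p i).2.1.le
  · exact le_rfl

theorem mass_pos_iff {D : Set S} : 0 < mass p Q D ↔ ∃ i, Q i ∈ D := by
  constructor
  · intro h
    obtain ⟨i, -, hi⟩ := Finset.exists_ne_zero_of_sum_ne_zero h.ne'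
    exact ⟨i, by_contra fun h => hi (if_neg h)⟩
  · rintro ⟨i, hi⟩
    refine Finset.sum_pos' (fun j _ => ?_) ⟨i, Finset.mem_univ _, by simpa [hi] using (p i).2.1⟩
    split_ifs
    · exact (p j).2.1.le
    · exact le_rfl

theorem mass_add_mass_compl (D : Set S) : mass p Q D + mass p Q Dᶜ = ∑ i, (p i : ℝ) := by
  rw [mass, mass, ← Finset.sum_add_distrib]
  refine Finset.sum_congr rfl fun i _ => ?_
  by_cases h : Q i ∈ D <;> simp [h]

end mass

/-- `D` is a union of classes of `E`. -/
def Saturated {S : Type v} (E : Setoid S) (D : Set S) : Prop := ∀ x ∈ D, ∀ y, E x y → y ∈ D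

theorem Saturated.anti {S : Type v} {E F : Setoid S} (h : F ≤ E) {D : Set S} (hD : Saturated E D) :
    Saturated F D := fun x hx y hy => hD x hx y (h hy)

theorem Saturated.compl {S : Type v} {E : Setoid S} {D : Set S} (hD : Saturated E D) :
    Saturated E Dᶜ := fun x hx y hy h => hx (hD y h x (E.symm hy))

theorem saturated_class {S : Type v} (E : Setoid S) (A : S) : Saturated E {B | E A B} :=
  fun _ hx _ hy => E.trans hx hy

/-- Two collective silent transitions induce the same conditional distribution on the classes of `E`
other than that of `A`. -/
def SameExit {S : Type v} (E : Setoid S) (A : S) {k k' : ℕ} (p : Fin k → Set.Ioo (0 : ℝ) 1)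
    (Q : Fin k → S) (p' : Fin k' → Set.Ioo (0 : ℝ) 1) (Q' : Fin k' → S) : Prop :=
  ∃ c : ℝ, 0 < c ∧ ∀ D, Saturated E D → A ∉ D → mass p Q D = c * mass p' Q' D

namespace SameExit

variable {S : Type v} {E F : Setoid S} {A : S} {k k' k'' : ℕ} {p : Fin k → Set.Ioo (0 : ℝ) 1}
  {Q : Fin k → S} {p' : Fin k' → Set.Ioo (0 : ℝ) 1} {Q' : Fin k' → S}
  {p'' : Fin k'' → Set.Ioo (0 : ℝ) 1} {Q'' : Fin k'' → S}

theorem refl : SameExit E A p Q p Q := ⟨1, one_pos, fun _ _ _ => (one_mul _).symm⟩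

/-- Sets saturated for `E` are saturated for the finer `F`. Testing on saturated sets rather than on
classes thus lets exits be compared across equivalences. -/
theorem trans {B : S} (hFE : F ≤ E) (hAB : E A B) (h : SameExit E A p Q p' Q')
    (h' : SameExit F B p' Q' p'' Q'') : SameExit E A p Q p'' Q'' := by
  obtain ⟨c, hc, h⟩ := h
  obtain ⟨c', hc', h'⟩ := h'
  refine ⟨c * c', mul_pos hc hc', fun D hD hA => ?_⟩
  rw [h D hD hA, h' D (hD.anti hFE) fun hB => hA (hD _ hB _ (E.symm hAB)), mul_assoc]

theorem exists_mem_iff (h : SameExit E A p Q p' Q') {D : Set S} (hD : Saturated E D)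
    (hA : A ∉ D) : (∃ i, Q i ∈ D) ↔ ∃ i, Q' i ∈ D := by
  obtain ⟨c, hc, h⟩ := h
  rw [← mass_pos_iff, ← mass_pos_iff, h D hD hA]
  exact mul_pos_iff_of_pos_left hc

/-- Apply `exists_mem_iff` to the complement of `D`, which avoids `A`. -/
theorem forall_mem (h : SameExit E A p Q p' Q') {D : Set S} (hD : Saturated E D) (hA : A ∈ D)
    (hQ : ∀ i, Q i ∈ D) (i : Fin k') : Q' i ∈ D := by
  by_contra hi
  obtain ⟨j, hj⟩ := (h.exists_mem_iff hD.compl fun h => h hA).2 ⟨i, hi⟩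
  exact hj (hQ j)

end SameExit

/-! ### Branching bisimulations without trees, and their joins -/

namespace TransSystem

variable {𝒜 : Type u} {S : Type v} {M : TransSystem 𝒜 S}

theorem arriveProb_eq {E : Setoid S} {k : ℕ} (p : Fin k → Set.Ioo (0 : ℝ) 1) (Q : Fin k → S)
    (C : Quotient E) : arriveProb E p Q C = mass p Q {s | Quotient.mk E s = C} := by
  unfold arriveProb mass
  refine Finset.sum_congr rfl fun i _ => ?_
  by_cases h : Quotient.mk E (Q i) = C <;> simp [h]

theorem one_sub_arriveProb (hM : M.IsAlternating) {E : Setoid S} {A L : S} {k : ℕ}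
    {p : Fin k → Set.Ioo (0 : ℝ) 1} {Q : Fin k → S} (hc : M.coll A k p Q) (hL : E L A) :
    1 - arriveProb E p Q (Quotient.mk E L) = mass p Q {B | E A B}ᶜ := by
  have h : {s | Quotient.mk E s = Quotient.mk E L} = {B | E A B} := by
    ext s
    exact Quotient.eq.trans ⟨fun h => E.symm (E.trans h hL), fun h => E.symm (E.trans hL h)⟩
  rw [arriveProb_eq, h, ← hM.sum_eq hc, ← mass_add_mass_compl {B | E A B}, add_sub_cancel_left]

/-- A saturated set is a union of classes, so membership of a class can be tested on its
representative; `T` only has to contain the classes of the targets. -/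
theorem mass_eq_sum_arriveProb {E : Setoid S} {k : ℕ} {p : Fin k → Set.Ioo (0 : ℝ) 1}
    {Q : Fin k → S} {D : Set S} (hD : Saturated E D) (T : Finset (Quotient E))
    (hT : ∀ i, Quotient.mk E (Q i) ∈ T) [DecidablePred fun C : Quotient E => C.out ∈ D] :
    mass p Q D = ∑ C ∈ T, if C.out ∈ D then arriveProb E p Q C else 0 := by
  classical
  rw [← Finset.sum_filter]
  unfold arriveProb
  rw [Finset.sum_comm, mass]
  refine Finset.sum_congr rfl fun i _ => ?_
  have h : (Quotient.mk E (Q i)).out ∈ D ↔ Q i ∈ D :=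
    ⟨fun h => hD _ h _ (Quotient.mk_out (Q i)), fun h => hD _ h _ (E.symm (Quotient.mk_out (Q i)))⟩
  simp [Finset.sum_ite_eq, hT i, h]

theorem sameExit_of_arriveProb {E : Setoid S} {A : S} {k k' : ℕ} {p : Fin k → Set.Ioo (0 : ℝ) 1}
    {Q : Fin k → S} {p' : Fin k' → Set.Ioo (0 : ℝ) 1} {Q' : Fin k' → S} {c : ℝ} (hc : 0 < c)
    (h : ∀ C ≠ Quotient.mk E A, arriveProb E p Q C = c * arriveProb E p' Q' C) :
    SameExit E A p Q p' Q' := by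
  classical
  refine ⟨c, hc, fun D hD hA => ?_⟩
  let T : Finset (Quotient E) := Finset.univ.image (fun i => Quotient.mk E (Q i)) ∪
    Finset.univ.image (fun i => Quotient.mk E (Q' i))
  rw [mass_eq_sum_arriveProb hD T (fun i => by simp [T]),
    mass_eq_sum_arriveProb hD T (fun i => by simp [T]), Finset.mul_sum]
  refine Finset.sum_congr rfl fun C _ => ?_
  split_ifs with hC
  · refine h C ?_
    rintro rfl
    exact hA (hD _ hC _ (Quotient.mk_out A))
  · rw [mul_zero]

/-- A characterization of branching bisimulations that mentions neither trees nor classes: every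
transition that leaves a class, or is visible, can almost surely be matched by any equivalent
state. -/
structure Simulates (M : TransSystem 𝒜 S) (E : Setoid S) : Prop where
  act : ∀ {A B l A'}, E A B → M.step A (.act l) A' → (l ≠ .tau ∨ ¬ E A A') →
    M.AlmostSure E B fun L => ∃ L', M.step L (.act l) L' ∧ E A' L'
  coll : ∀ {A B k p Q}, E A B → M.coll A k p Q → (∃ j, ¬ E A (Q j)) →
    M.AlmostSure E B fun L => ∃ k' p' Q', M.coll L k' p' Q' ∧ SameExit E A p Q p' Q'

/-- A collective silent transition that leaves the class is the only way to proceed. -/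
theorem AlmostSure.of_coll (hM : M.IsAlternating) {E : Setoid S} {A : S} {G : S → Prop} {k : ℕ}
    {p : Fin k → Set.Ioo (0 : ℝ) 1} {Q : Fin k → S} (h : M.AlmostSure E A G) (hc : M.coll A k p Q)
    (hj : ∃ j, ¬ E A (Q j)) : G A := by
  obtain ⟨X, hA, hE, hX⟩ := h
  obtain ⟨n, hn⟩ := hX A hA
  cases hn with
  | here _ h => exact h
  | tau _ hs _ => exact absurd hs (hM.not_act hc)
  | coll _ _ hc' hQ _ =>
    obtain ⟨j, hj⟩ := hj
    cases hM.unique hc hc'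
    exact absurd (hE _ (hQ j)) hj

/-- In the collective case the difficulty is that the definition treats each target class with its
own tree. A leaf `L` of one of these trees leaves its class by a collective transition; for every
other target class, `AlmostSure.of_coll` shows that `L` already satisfies the goal, and uniqueness
makes it the same collective transition. So one transition of `L` has all the right conditional
probabilities. -/
theorem IsBranchingBisim.simulates (hM : M.IsAlternating) {E : Setoid S}
    (h : M.IsBranchingBisim E) : M.Simulates E where
  act {A B l A'} hAB hs hl := by
    have h1 : M.LTrans E A l (Quotient.mk E A') :=
      ⟨hl.imp id fun hn he => hn (E.symm (Quotient.eq.1 he)),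
        (exists_regular_iff hM (G := fun L => ∃ L', M.step L (.act l) L' ∧
          Quotient.mk E L' = Quotient.mk E A')).2 (.of_goal ⟨A', hs, rfl⟩)⟩
    have h2 := (exists_regular_iff hM (G := fun L => ∃ L', M.step L (.act l) L' ∧
          Quotient.mk E L' = Quotient.mk E A')).1 ((h A B hAB _).1 _ h1).2
    exact h2.mono fun L _ ⟨L', hL, hL'⟩ => ⟨L', hL, E.symm (Quotient.eq.1 hL')⟩
  coll {A B k p Q} hAB hc hj := by
    let G : ℝ → Quotient E → S → Prop := fun q C L => ∃ k p Q, M.coll L k p Q ∧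
      arriveProb E p Q (Quotient.mk E L) < 1 ∧
      arriveProb E p Q C / (1 - arriveProb E p Q (Quotient.mk E L)) = q
    let r : Quotient E → ℝ := fun C =>
      arriveProb E p Q C / (1 - arriveProb E p Q (Quotient.mk E A))
    have hlt : arriveProb E p Q (Quotient.mk E A) < 1 := by
      rw [← sub_pos, one_sub_arriveProb hM hc (E.refl A)]
      exact mass_pos_iff.2 hj
    have key : ∀ B, E A B → ∀ C ≠ Quotient.mk E A, M.AlmostSure E B (G (r C) C) := by
      intro B hAB C hC
      have h1 : M.QTrans E A (r C) C :=
        ⟨hC, (exists_regular_iff hM (G := G (r C) C)).2 (.of_goal ⟨k, p, Q, hc, hlt, rfl⟩)⟩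
      exact (exists_regular_iff hM (G := G (r C) C)).1 ((h A B hAB C).2 _ h1).2
    obtain ⟨j, hj⟩ := hj
    refine (key B hAB (Quotient.mk E (Q j))
      fun he => hj (E.symm (Quotient.eq.1 he))).mono fun L hBL hG => ?_
    obtain ⟨k', p', Q', hc', hlt', -⟩ := hG
    refine ⟨k', p', Q', hc', ?_⟩
    have hAL : E A L := E.trans hAB hBL
    have hj' : ∃ j, ¬ E L (Q' j) := by
      rw [← sub_pos, one_sub_arriveProb hM hc' (E.refl L)] at hlt'
      exact mass_pos_iff.1 hlt'
    have hp := sub_pos.2 hlt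
    have hp' := sub_pos.2 hlt'
    -- The factor is the ratio of the probabilities with which the two transitions leave the class.
    refine sameExit_of_arriveProb (div_pos hp hp') fun C hC => ?_
    obtain ⟨k'', p'', Q'', hc'', -, hq⟩ := (key L hAL C hC).of_coll hM hc' hj'
    cases hM.unique hc' hc''
    simp only [r] at hq
    rw [div_eq_div_iff hp'.ne' hp.ne'] at hq
    field_simp
    linarith

/-- A single leaf of the tree of `A` suffices: it is equivalent to `B`, so its transition can be
matched from `B`. For collective transitions the factor in `SameExit` cancels in the conditional
probability. -/
theorem Simulates.isBranchingBisim (hM : M.IsAlternating) {E : Setoid S} (h : M.Simulates E) :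
    M.IsBranchingBisim E := by
  intro A B hAB C
  have hmk : Quotient.mk E A = Quotient.mk E B := Quotient.sound hAB
  constructor
  · rintro l ⟨hl, ht⟩
    refine ⟨hmk ▸ hl, ?_⟩
    obtain ⟨L, hAL, L', hs, rfl⟩ := ((exists_regular_iff hM (G := fun L => ∃ L',
      M.step L (.act l) L' ∧ Quotient.mk E L' = C)).1 ht).exists_goal
    refine (exists_regular_iff hM (G := fun L => ∃ L₁,
      M.step L (.act l) L₁ ∧ Quotient.mk E L₁ = Quotient.mk E L')).2 ?_
    refine (h.act (E.trans (E.symm hAL) hAB) hs (hl.imp id fun hn he =>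
      hn (Quotient.sound (E.symm (E.trans hAL he))))).mono ?_
    rintro L₁ - ⟨L₂, h1, h2⟩
    exact ⟨L₂, h1, Quotient.sound (E.symm h2)⟩
  · rintro q ⟨hC, ht⟩
    refine ⟨hmk ▸ hC, ?_⟩
    let G : S → Prop := fun L => ∃ k p Q, M.coll L k p Q ∧
      arriveProb E p Q (Quotient.mk E L) < 1 ∧
      arriveProb E p Q C / (1 - arriveProb E p Q (Quotient.mk E L)) = q
    obtain ⟨L, hAL, k, p, Q, hc, hlt, hq⟩ := ((exists_regular_iff hM (G := G)).1 ht).exists_goal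
    refine (exists_regular_iff hM (G := G)).2 ?_
    rw [← sub_pos] at hlt
    rw [one_sub_arriveProb hM hc (E.refl L)] at hlt hq
    refine (h.coll (E.trans (E.symm hAL) hAB) hc (mass_pos_iff.1 hlt)).mono ?_
    rintro L₁ hBL ⟨k', p', Q', hc', κ, hκ, hD⟩
    have hcl : 1 - arriveProb E p' Q' (Quotient.mk E L₁) = mass p' Q' {B | E L B}ᶜ := by
      have hLL : E L L₁ := E.trans (E.symm hAL) (E.trans hAB hBL)
      rw [one_sub_arriveProb hM hc' (E.refl L₁)]
      congr 2
      ext s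
      exact ⟨fun h => E.trans hLL h, fun h => E.trans (E.symm hLL) h⟩
    have h1 := hD _ (saturated_class E L).compl fun h => h (E.refl L)
    have h2 := hD {s | Quotient.mk E s = C} (fun x hx y hy => (Quotient.sound (E.symm hy)).trans hx)
      fun hL => hC (hL.symm.trans (Quotient.sound (E.symm hAL)))
    refine ⟨k', p', Q', hc', ?_, ?_⟩
    · rw [← sub_pos, hcl]
      rw [h1] at hlt
      exact pos_of_mul_pos_right hlt hκ.le
    · rw [hcl, arriveProb_eq]
      rw [arriveProb_eq, h1, h2, mul_div_mul_left _ _ hκ.ne'] at hq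
      exact hq

/-- The states that are `F`-equivalent to a state in `X`. -/
def saturation (F : Setoid S) (X : Set S) : Set S := {B | ∃ A ∈ X, F A B}

theorem saturated_saturation (F : Setoid S) (X : Set S) : Saturated F (saturation F X) :=
  fun _ ⟨A, hA, hx⟩ _ hy => ⟨A, hA, F.trans hx hy⟩

/-- The `F`-saturation of `X` works for `B`. A state equivalent to a member of `X` imitates the path
of that member to the goal: steps inside an `F`-class are answered by waiting, steps out of it by
`F`-simulation, and reaching the goal by `hG`. -/
theorem AlmostSure.transfer {E F : Setoid S} (hF : M.Simulates F) (hFE : F ≤ E)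
    {G : S → Prop} {A B : S} (hAB : F A B)
    (hG : ∀ L L', E A L → G L → F L L' → M.AlmostSure F L' G) (h : M.AlmostSure E A G) :
    M.AlmostSure E B G := by
  obtain ⟨X, hA, hE, hX⟩ := h
  have hsub : ∀ {A' B' : S} {Z : Set S}, A' ∈ X → F A' B' → (∀ C ∈ Z, F B' C) →
      Z ⊆ saturation F X := fun hA' hB' hZ C hC => ⟨_, hA', F.trans hB' (hZ C hC)⟩
  refine ⟨saturation F X, ⟨A, hA, hAB⟩, fun C ⟨A', hA', h'⟩ =>
    E.trans (E.symm (hFE hAB)) (E.trans (hE A' hA') (hFE h')), ?_⟩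
  rintro B' ⟨A', hA', hB'⟩
  obtain ⟨n, hn⟩ := hX A' hA'
  clear hA'
  induction hn generalizing B' with
  | here hA' h =>
    obtain ⟨Z, hZ, hZF, hZl⟩ := hG _ B' (hE _ hA') h hB'
    obtain ⟨n, hn⟩ := hZl _ hZ
    have hs := hsub hA' hB' hZF
    exact hn.bind hs fun L hL h => ⟨0, .here (hs hL) h⟩
  | @tau n A' A₁ hA' hs hl ih =>
    by_cases hstay : F A' A₁
    · exact ih B' (F.trans (F.symm hstay) hB')
    · obtain ⟨Z, hZ, hZF, hZl⟩ := hF.act hB' hs (Or.inr hstay)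
      obtain ⟨n, hn⟩ := hZl _ hZ
      have hsub := hsub hA' hB' hZF
      refine hn.bind hsub fun L hL ⟨L', hLs, hL'⟩ => ?_
      obtain ⟨m, hm⟩ := ih L' hL'
      exact ⟨m + 1, .tau (hsub hL) hLs hm⟩
  | @coll n k A' p Q j hA' hc hQ hl ih =>
    by_cases hstay : F A' (Q j)
    · exact ih B' (F.trans (F.symm hstay) hB')
    · obtain ⟨Z, hZ, hZF, hZl⟩ := hF.coll hB' hc ⟨j, hstay⟩
      obtain ⟨n, hn⟩ := hZl _ hZ
      have hsub := hsub hA' hB' hZF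
      refine hn.bind hsub fun L hL ⟨k', p', Q', hc', hex⟩ => ?_
      -- Not only the chosen target but all targets of the matching transition must stay in the
      -- saturation.
      have hQ' := hex.forall_mem (saturated_saturation F X) ⟨A', hA', F.refl A'⟩
        fun i => ⟨_, hQ i, F.refl _⟩
      -- The class of `Q j` is left with positive conditional probability, hence also hit by the
      -- matching transition.
      obtain ⟨i, hi⟩ := (hex.exists_mem_iff (saturated_class F (Q j))
        fun h => hstay (F.symm h)).1 ⟨j, F.refl _⟩
      obtain ⟨m, hm⟩ := ih _ hi
      exact ⟨m + 1, .coll i (hsub hL) hc' hQ' hm⟩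

/-- The join of a set of branching bisimulations is a branching bisimulation. -/
theorem Simulates.sSup {s : Set (Setoid S)} (hs : ∀ F ∈ s, M.Simulates F) :
    M.Simulates (sSup s) := by
  set E := SupSet.sSup s with hE
  have hle : ∀ F ∈ s, F ≤ E := fun F hF => le_sSup hF
  -- The join is generated by chains of steps from members of `s`; a goal that each member can
  -- transfer is carried along the chain.
  have main : ∀ {A : S} {G : S → Prop}, (∀ F ∈ s, ∀ L L', E A L → G L → F L L' →
      M.AlmostSure F L' G) → M.AlmostSure E A G → ∀ {B}, E A B → M.AlmostSure E B G := by
    intro A G hG hA B hAB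
    have : Relation.EqvGen (fun x y => ∃ F ∈ s, F x y) A B := by
      rw [hE, Setoid.sSup_eq_eqvGen] at hAB
      exact hAB
    have hiff : E A B ∧ M.AlmostSure E B G := by
      -- An equivalence is proved so that symmetric steps pass through the induction; `E A x` is
      -- carried along because `hG` only covers states equivalent to `A`.
      have : ∀ {x y}, Relation.EqvGen (fun x y => ∃ F ∈ s, F x y) x y →
          ((E A x ∧ M.AlmostSure E x G) ↔ (E A y ∧ M.AlmostSure E y G)) := by
        intro x y h
        induction h with
        | rel x y h =>
          obtain ⟨F, hF, hxy⟩ := h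
          have step : ∀ x y, F x y → (E A x ∧ M.AlmostSure E x G) →
              (E A y ∧ M.AlmostSure E y G) := fun x y hxy h =>
            ⟨E.trans h.1 (hle F hF hxy), h.2.transfer (hs F hF) (hle F hF) hxy
              fun L L' hL => hG F hF L L' (E.trans h.1 hL)⟩
          exact ⟨step x y hxy, step y x (F.symm hxy)⟩
        | refl x => exact Iff.rfl
        | symm x y _ ih => exact ih.symm
        | trans x y z _ _ ih ih' => exact ih.trans ih'
      exact (this ‹_›).1 ⟨E.refl A, hA⟩
    exact hiff.2
  constructor
  · intro A B l A' hAB hst hl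
    refine main ?_ (.of_goal ⟨A', hst, E.refl A'⟩) hAB
    rintro F hF L L' hAL ⟨L₁, hL₁, hA'⟩ hLL'
    refine ((hs F hF).act hLL' hL₁ (hl.imp id fun hn he =>
      hn (E.trans hAL (E.trans (hle F hF he) (E.symm hA'))))).mono ?_
    rintro L₂ - ⟨L₃, h1, h2⟩
    exact ⟨L₃, h1, E.trans hA' (hle F hF h2)⟩
  · intro A B k p Q hAB hc hj
    refine main ?_ (.of_goal ⟨k, p, Q, hc, .refl⟩) hAB
    rintro F hF L L' hAL ⟨k', p', Q', hc', hex⟩ hLL'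
    obtain ⟨i, hi⟩ := (hex.exists_mem_iff (saturated_class E A).compl fun h => h (E.refl A)).1 hj
    refine ((hs F hF).coll hLL' hc' ⟨i, fun h => hi (E.trans hAL (hle F hF h))⟩).mono ?_
    rintro L₂ - ⟨k'', p'', Q'', hc'', hex'⟩
    exact ⟨k'', p'', Q'', hc'', hex.trans (hle F hF) hAL hex'⟩

/-! ### Divergence -/

/-- The `F`-saturation of a trap `U` is again a trap. Let `Q` be equivalent to `P` in `U`. If some
state of `U` in their `F`-class can move inside `U` with a target outside that class, `Q` imitates
this. Otherwise the part of `U` in the class is a trap, so `P` diverges for `F`, and `Q` does so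
because `F` respects divergence. -/
theorem Simulates.diverges_of_le (hM : M.IsAlternating) {E F : Setoid S} (hF : M.Simulates F)
    (hdiv : M.IsDivPreserving F) (hFE : F ≤ E) {A B : S} (hAB : F A B) (h : M.Diverges E A) :
    M.Diverges E B := by
  obtain ⟨U, hA, hE, hU⟩ := (diverges_iff hM).1 h
  refine (diverges_iff hM).2 ⟨saturation F U, ⟨A, hA, hAB⟩, fun C ⟨A', hA', h'⟩ =>
    E.trans (E.symm (hFE hAB)) (E.trans (hE A' hA') (hFE h')), ?_⟩
  rintro Q ⟨P, hP, hPQ⟩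
  have hmem : ∀ {C}, F Q C → C ∈ saturation F U := fun h => ⟨P, hP, F.trans hPQ h⟩
  -- The first step of `Q` towards the goal stays in its `F`-class, hence in the saturation; if `Q`
  -- is at the goal already, the goal itself provides the move.
  have hlead : ∀ {G : S → Prop}, M.AlmostSure F Q G → (G Q → (∃ B' ∈ saturation F U,
      M.step Q (.act .tau) B') ∨ ∃ (k : ℕ) (p : Fin k → Set.Ioo (0 : ℝ) 1) (Q' : Fin k → S),
      M.coll Q k p Q' ∧ ∀ i, Q' i ∈ saturation F U) → (∃ B' ∈ saturation F U,
      M.step Q (.act .tau) B') ∨ ∃ (k : ℕ) (p : Fin k → Set.Ioo (0 : ℝ) 1) (Q' : Fin k → S),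
      M.coll Q k p Q' ∧ ∀ i, Q' i ∈ saturation F U := by
    rintro G ⟨Z, hQ, hZ, hl⟩ hG
    obtain ⟨n, hn⟩ := hl Q hQ
    cases hn with
    | here _ h => exact hG h
    | tau _ hs h => exact Or.inl ⟨_, hmem (hZ _ h.mem), hs⟩
    | coll _ _ hc hQ' _ => exact Or.inr ⟨_, _, _, hc, fun i => hmem (hZ _ (hQ' i))⟩
  by_cases hstay : ∃ P' ∈ U, F P' Q ∧ ((∃ R ∈ U, M.step P' (.act .tau) R ∧ ¬ F P' R) ∨
      ∃ (k : ℕ) (p : Fin k → Set.Ioo (0 : ℝ) 1) (R : Fin k → S), M.coll P' k p R ∧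
        (∀ i, R i ∈ U) ∧ ∃ j, ¬ F P' (R j))
  · obtain ⟨P', hP', hF', ⟨R, hR, hs, hn⟩ | ⟨k, p, R, hc, hR, hj⟩⟩ := hstay
    · refine hlead (hF.act hF' hs (Or.inr hn)) ?_
      rintro ⟨L', hL', hRL⟩
      exact Or.inl ⟨L', ⟨R, hR, hRL⟩, hL'⟩
    · refine hlead (hF.coll hF' hc hj) ?_
      rintro ⟨k', p', Q', hc', hex⟩
      exact Or.inr ⟨k', p', Q', hc', hex.forall_mem (saturated_saturation F U)
        ⟨P', hP', F.refl _⟩ fun i => ⟨_, hR i, F.refl _⟩⟩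
  · have hP' : M.Diverges F P := by
      refine (diverges_iff hM).2 ⟨U ∩ {C | F P C}, ⟨hP, F.refl P⟩, fun _ h => h.2, ?_⟩
      rintro P' ⟨hP', hPP'⟩
      have hPQ' : F P' Q := F.trans (F.symm hPP') hPQ
      rcases hU P' hP' with ⟨R, hR, hs⟩ | ⟨k, p, R, hc, hR⟩
      · refine Or.inl ⟨R, ⟨hR, F.trans hPP' (by_contra fun hn => ?_)⟩, hs⟩
        exact hstay ⟨P', hP', hPQ', Or.inl ⟨R, hR, hs, hn⟩⟩
      · refine Or.inr ⟨k, p, R, hc, fun i => ⟨hR i, F.trans hPP' (by_contra fun hn => ?_)⟩⟩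
        exact hstay ⟨P', hP', hPQ', Or.inr ⟨k, p, R, hc, hR, i, hn⟩⟩
    obtain ⟨V, hV, hVF, hVt⟩ := (diverges_iff hM).1 ((hdiv P Q hPQ).1 hP')
    rcases hVt Q hV with ⟨R, hR, hs⟩ | ⟨k, p, R, hc, hR⟩
    · exact Or.inl ⟨R, hmem (hVF R hR), hs⟩
    · exact Or.inr ⟨k, p, R, hc, fun i => hmem (hVF _ (hR i))⟩

end TransSystem

/-! ### Transfer along functional bisimulations -/

namespace TransSystem

variable {𝒜 : Type u} {S S' : Type v} {M : TransSystem 𝒜 S} {N : TransSystem 𝒜 S'}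

/-- The transitions of `f r` are exactly the images of the transitions of `r`. -/
structure IsFunctionalBisim (N : TransSystem 𝒜 S') (M : TransSystem 𝒜 S) (f : S' → S) : Prop where
  step_iff : ∀ {r l P}, M.step (f r) l P ↔ ∃ r', f r' = P ∧ N.step r l r'
  coll_iff : ∀ {r k p Q}, M.coll (f r) k p Q ↔ ∃ q : Fin k → S', (fun i => f (q i)) = Q ∧
    N.coll r k p q

variable {f : S' → S} {E : Setoid S}

theorem AlmostSure.map (hf : N.IsFunctionalBisim M f) {A : S'} {G' : S' → Prop} {G : S → Prop}
    (hG : ∀ L, G' L → G (f L)) (h : N.AlmostSure (E.comap f) A G') :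
    M.AlmostSure E (f A) G := by
  obtain ⟨X, hA, hE, hX⟩ := h
  refine ⟨f '' X, ⟨A, hA, rfl⟩, ?_, ?_⟩
  · rintro _ ⟨B, hB, rfl⟩
    exact hE B hB
  · rintro _ ⟨B, hB, rfl⟩
    obtain ⟨n, hn⟩ := hX B hB
    refine ⟨n, ?_⟩
    clear hB
    induction hn with
    | here hB h => exact .here ⟨_, hB, rfl⟩ (hG _ h)
    | tau hB hs _ ih => exact .tau ⟨_, hB, rfl⟩ (hf.step_iff.2 ⟨_, rfl, hs⟩) ih
    | coll j hB hc hQ _ ih =>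
      exact .coll j ⟨_, hB, rfl⟩ (hf.coll_iff.2 ⟨_, rfl, hc⟩) (fun i => ⟨_, hQ i, rfl⟩) ih

theorem AlmostSure.comap (hf : N.IsFunctionalBisim M f) {A : S'} {G' : S' → Prop} {G : S → Prop}
    (hG : ∀ L, G (f L) → G' L) (h : M.AlmostSure E (f A) G) :
    N.AlmostSure (E.comap f) A G' := by
  obtain ⟨X, hA, hE, hX⟩ := h
  refine ⟨f ⁻¹' X, hA, fun B hB => hE _ hB, fun B hB => ?_⟩
  obtain ⟨n, hn⟩ := hX _ hB
  refine ⟨n, ?_⟩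
  clear hB
  generalize hP : f B = P at hn
  induction hn generalizing B with
  | here hB h =>
    subst hP
    exact .here hB (hG _ h)
  | tau hB hs _ ih =>
    subst hP
    obtain ⟨B', rfl, hs'⟩ := hf.step_iff.1 hs
    exact .tau hB hs' (ih B' rfl)
  | coll j hB hc hQ _ ih =>
    subst hP
    obtain ⟨Q', rfl, hc'⟩ := hf.coll_iff.1 hc
    exact .coll j hB hc' hQ (ih _ rfl)

theorem IsFunctionalBisim.diverges_iff (hf : N.IsFunctionalBisim M f) (hM : M.IsAlternating)
    (hN : N.IsAlternating) {A : S'} : N.Diverges (E.comap f) A ↔ M.Diverges E (f A) := by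
  rw [TransSystem.diverges_iff hM, TransSystem.diverges_iff hN]
  constructor
  · rintro ⟨U, hA, hE, hU⟩
    refine ⟨f '' U, ⟨A, hA, rfl⟩, ?_, ?_⟩
    · rintro _ ⟨B, hB, rfl⟩
      exact hE B hB
    · rintro _ ⟨B, hB, rfl⟩
      rcases hU B hB with ⟨B', hB', hs⟩ | ⟨k, p, Q, hc, hQ⟩
      · exact Or.inl ⟨_, ⟨B', hB', rfl⟩, hf.step_iff.2 ⟨_, rfl, hs⟩⟩
      · exact Or.inr ⟨k, p, _, hf.coll_iff.2 ⟨Q, rfl, hc⟩, fun i => ⟨_, hQ i, rfl⟩⟩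
  · rintro ⟨U, hA, hE, hU⟩
    refine ⟨f ⁻¹' U, hA, fun B hB => hE _ hB, fun B hB => ?_⟩
    rcases hU _ hB with ⟨B', hB', hs⟩ | ⟨k, p, Q, hc, hQ⟩
    · obtain ⟨B', rfl, hs'⟩ := hf.step_iff.1 hs
      exact Or.inl ⟨B', hB', hs'⟩
    · obtain ⟨Q, rfl, hc'⟩ := hf.coll_iff.1 hc
      exact Or.inr ⟨k, p, Q, hc', hQ⟩

theorem _root_.RCCS.SameExit.map {r : S'} {k k' : ℕ} {p : Fin k → Set.Ioo (0 : ℝ) 1} {Q : Fin k → S'}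
    {p' : Fin k' → Set.Ioo (0 : ℝ) 1} {Q' : Fin k' → S'}
    (h : SameExit (E.comap f) r p Q p' Q') :
    SameExit E (f r) p (fun i => f (Q i)) p' fun i => f (Q' i) := by
  obtain ⟨c, hc, h⟩ := h
  exact ⟨c, hc, fun D hD hr => h (f ⁻¹' D) (fun x hx y hy => hD _ hx _ hy) hr⟩

theorem _root_.RCCS.SameExit.comap {r : S'} {k k' : ℕ} {p : Fin k → Set.Ioo (0 : ℝ) 1} {Q : Fin k → S'}
    {p' : Fin k' → Set.Ioo (0 : ℝ) 1} {Q' : Fin k' → S'}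
    (h : SameExit E (f r) p (fun i => f (Q i)) p' fun i => f (Q' i)) :
    SameExit (E.comap f) r p Q p' Q' := by
  obtain ⟨c, hc, h⟩ := h
  refine ⟨c, hc, fun D hD hr => ?_⟩
  -- Every saturated set of the pullback is the preimage of a saturated set.
  have hD' : f ⁻¹' saturation E (f '' D) = D := by
    ext x
    constructor
    · rintro ⟨_, ⟨y, hy, rfl⟩, hyx⟩
      exact hD y hy x hyx
    · exact fun hx => ⟨_, ⟨x, hx, rfl⟩, E.refl _⟩
  have hr' : f r ∉ saturation E (f '' D) := fun h => hr (hD' ▸ h)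
  have := h _ (saturated_saturation E _) hr'
  rwa [← hD']

theorem Simulates.comap (hf : N.IsFunctionalBisim M f) (h : M.Simulates E) :
    N.Simulates (E.comap f) where
  act {A B _ A'} hAB hs hl := by
    refine (h.act (A := f A) (B := f B) hAB (hf.step_iff.2 ⟨A', rfl, hs⟩) hl).comap hf ?_
    rintro L ⟨L', hL, hL'⟩
    obtain ⟨L', rfl, hs'⟩ := hf.step_iff.1 hL
    exact ⟨L', hs', hL'⟩
  coll {A B k p Q} hAB hc hj := by
    refine (h.coll (A := f A) (B := f B) hAB (hf.coll_iff.2 ⟨Q, rfl, hc⟩) hj).comap hf ?_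
    rintro L ⟨k', p', Q', hc', hex⟩
    obtain ⟨Q', rfl, hc''⟩ := hf.coll_iff.1 hc'
    exact ⟨k', p', Q', hc'', hex.comap⟩

/-- By `hE`, a state outside the image of `f` is related only to itself and matches its own
transitions. -/
theorem Simulates.of_comap (hf : N.IsFunctionalBisim M f)
    (hE : ∀ P Q, E P Q → P = Q ∨ ∃ r r', f r = P ∧ f r' = Q) (h : N.Simulates (E.comap f)) :
    M.Simulates E where
  act hAB hs hl := by
    obtain rfl | ⟨r, r', rfl, rfl⟩ := hE _ _ hAB
    · exact .of_goal ⟨_, hs, E.refl _⟩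
    · obtain ⟨_, rfl, hs'⟩ := hf.step_iff.1 hs
      refine (h.act hAB hs' hl).map hf ?_
      rintro L ⟨L', hL, hL'⟩
      exact ⟨f L', hf.step_iff.2 ⟨L', rfl, hL⟩, hL'⟩
  coll hAB hc hj := by
    obtain rfl | ⟨r, r', rfl, rfl⟩ := hE _ _ hAB
    · exact .of_goal ⟨_, _, _, hc, .refl⟩
    · obtain ⟨Q, rfl, hc'⟩ := hf.coll_iff.1 hc
      refine (h.coll hAB hc' hj).map hf ?_
      rintro L ⟨k', p', Q', hL, hex⟩
      exact ⟨k', p', _, hf.coll_iff.2 ⟨Q', rfl, hL⟩, hex.map⟩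

theorem IsBranchingBisimDiv.comap (hf : N.IsFunctionalBisim M f) (hM : M.IsAlternating)
    (hN : N.IsAlternating) (h : M.IsBranchingBisimDiv E) : N.IsBranchingBisimDiv (E.comap f) :=
  ⟨((h.1.simulates hM).comap hf).isBranchingBisim hN, fun _ _ hAB =>
    (hf.diverges_iff hM hN).trans ((h.2 _ _ hAB).trans (hf.diverges_iff hM hN).symm)⟩

theorem IsBranchingBisimDiv.of_comap (hf : N.IsFunctionalBisim M f) (hM : M.IsAlternating)
    (hN : N.IsAlternating) (hE : ∀ P Q, E P Q → P = Q ∨ ∃ r r', f r = P ∧ f r' = Q)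
    (h : N.IsBranchingBisimDiv (E.comap f)) : M.IsBranchingBisimDiv E := by
  refine ⟨((h.1.simulates hN).of_comap hf hE).isBranchingBisim hM, fun P Q hPQ => ?_⟩
  obtain rfl | ⟨r, r', rfl, rfl⟩ := hE P Q hPQ
  · exact Iff.rfl
  · exact (hf.diverges_iff hM hN).symm.trans ((h.2 r r' hPQ).trans (hf.diverges_iff hM hN))

theorem isBranchingBisimDiv_bot (M : TransSystem 𝒜 S) : M.IsBranchingBisimDiv ⊥ :=
  ⟨by rintro A B ⟨⟩ C; exact ⟨fun _ h => h, fun _ h => h⟩, by rintro A B ⟨⟩; exact Iff.rfl⟩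

/-- The image of `E` under `f`, if `E` identifies states with equal images. -/
def extend (f : S' → S) (E : Setoid S') (h : Setoid.ker f ≤ E) : Setoid S where
  r P Q := P = Q ∨ ∃ r r', f r = P ∧ f r' = Q ∧ E r r'
  iseqv := by
    refine ⟨fun _ => Or.inl rfl, ?_, ?_⟩
    · rintro _ _ (rfl | ⟨r, r', rfl, rfl, hr⟩)
      · exact Or.inl rfl
      · exact Or.inr ⟨r', r, rfl, rfl, E.symm hr⟩
    · rintro _ _ _ (rfl | ⟨r, r', rfl, rfl, hr⟩) (rfl | ⟨s, s', hs, rfl, hs'⟩)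
      · exact Or.inl rfl
      · exact Or.inr ⟨s, s', hs, rfl, hs'⟩
      · exact Or.inr ⟨r, r', rfl, rfl, hr⟩
      · exact Or.inr ⟨r, s', rfl, rfl, E.trans hr (E.trans (h hs.symm) hs')⟩

theorem comap_extend (f : S' → S) (E : Setoid S') (h : Setoid.ker f ≤ E) :
    (extend f E h).comap f = E := by
  ext x y
  constructor
  · rintro (hxy | ⟨r, r', hr, hr', hE⟩)
    · exact h hxy
    · exact E.trans (h hr.symm) (E.trans hE (h hr'))
  · exact fun hE => Or.inr ⟨x, y, rfl, rfl, hE⟩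

/-- If `E` is the largest branching bisimulation with explicit divergence on the domain of a
functional bisimulation, then it is the restriction of one on the codomain. -/
theorem exists_comap_eq (hf : N.IsFunctionalBisim M f) (hM : M.IsAlternating)
    (hN : N.IsAlternating) {E : Setoid S'} (h : N.IsBranchingBisimDiv E)
    (hmax : ∀ F, N.IsBranchingBisimDiv F → F ≤ E) :
    ∃ E' : Setoid S, M.IsBranchingBisimDiv E' ∧ E'.comap f = E := by
  -- The kernel is the pullback of equality, which is a branching bisimulation with explicit
  -- divergence.
  have hker : Setoid.ker f ≤ E := hmax _ ((isBranchingBisimDiv_bot M).comap hf hM hN)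
  refine ⟨extend f E hker, .of_comap hf hM hN ?_ ((comap_extend f E hker).symm ▸ h),
    comap_extend f E hker⟩
  rintro P Q (rfl | ⟨r, r', hr, hr', -⟩)
  · exact Or.inl rfl
  · exact Or.inr ⟨r, r', hr, hr'⟩

/-! ### Restriction and disjoint union -/

theorem IsAlternating.restrict (hM : M.IsAlternating) (V : Set S) [Finite V] :
    (M.restrict V).IsAlternating where
  two_le h := hM.two_le h
  sum_eq h := hM.sum_eq h
  unique {A k p Q k' p' Q'} h h' := by
    have := hM.unique h h'
    obtain ⟨rfl, h2⟩ := Sigma.mk.inj_iff.1 this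
    obtain ⟨rfl, h3⟩ := Prod.mk.inj (eq_of_heq h2)
    obtain rfl : Q = Q' := funext fun i => Subtype.ext (congrFun h3 i)
    rfl
  not_act h := hM.not_act h
  step_prob h := (hM.step_prob h).trans <| exists_congr fun _ => and_congr_right fun _ =>
    Subtype.ext_iff.symm
  finite_reach _ := Set.toFinite _

theorem IsAlternating.disjUnion [Finite S] [Finite S'] (hM : M.IsAlternating)
    (hN : N.IsAlternating) : (M.disjUnion N).IsAlternating where
  two_le := by
    rintro (A | A) k p Q ⟨Q', -, h⟩
    · exact hM.two_le h
    · exact hN.two_le h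
  sum_eq := by
    rintro (A | A) k p Q ⟨Q', -, h⟩
    · exact hM.sum_eq h
    · exact hN.sum_eq h
  unique := by
    rintro (A | A) k p Q k' p' Q' ⟨R, hR, h⟩ ⟨R', hR', h'⟩
    · cases hM.unique h h'
      obtain rfl : Q = Q' := funext fun i => (hR i).trans (hR' i).symm
      rfl
    · cases hN.unique h h'
      obtain rfl : Q = Q' := funext fun i => (hR i).trans (hR' i).symm
      rfl
  not_act := by
    rintro (A | A) k p Q α (B | B) ⟨R, hR, h⟩
    · exact hM.not_act h
    · exact id
    · exact id
    · exact hN.not_act h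
  step_prob := by
    rintro (A | A) k p Q q (B | B) ⟨R, hR, h⟩
    · exact (hM.step_prob h).trans (by simp [hR])
    · exact iff_of_false id fun ⟨j, _, hj⟩ => by simp [hR] at hj
    · exact iff_of_false id fun ⟨j, _, hj⟩ => by simp [hR] at hj
    · exact (hN.step_prob h).trans (by simp [hR])
  finite_reach _ := Set.toFinite _

/-- Each part is closed under transitions, collective ones included, since their targets are reached
by single probabilistic steps. -/
theorem isFunctionalBisim_disjUnion (hM : M.IsAlternating) (A B : S) :
    ((M.restrict (M.reach A)).disjUnion (M.restrict (M.reach B))).IsFunctionalBisim M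
      (Sum.elim Subtype.val Subtype.val) where
  step_iff := by
    rintro (r | r) l P
    · refine ⟨fun h => ⟨.inl ⟨P, .tail r.2 ⟨l, h⟩⟩, rfl, h⟩, ?_⟩
      rintro ⟨r' | r', rfl, h⟩
      · exact h
      · exact h.elim
    · refine ⟨fun h => ⟨.inr ⟨P, .tail r.2 ⟨l, h⟩⟩, rfl, h⟩, ?_⟩
      rintro ⟨r' | r', rfl, h⟩
      · exact h.elim
      · exact h
  coll_iff := by
    rintro (r | r) k p Q
    · refine ⟨fun h => ⟨fun i => .inl ⟨Q i, .tail r.2 ⟨_, step_of_coll hM h i⟩⟩, rfl,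
        _, fun i => rfl, h⟩, ?_⟩
      rintro ⟨q, rfl, q', hq, h⟩
      obtain rfl : q = fun i => .inl (q' i) := funext hq
      exact h
    · refine ⟨fun h => ⟨fun i => .inr ⟨Q i, .tail r.2 ⟨_, step_of_coll hM h i⟩⟩, rfl,
        _, fun i => rfl, h⟩, ?_⟩
      rintro ⟨q, rfl, q', hq, h⟩
      obtain rfl : q = fun i => .inr (q' i) := funext hq
      exact h

end TransSystem

/-- A loop whose body always succeeds, preserves the invariant and decreases a well-founded measure
whenever it demands another execution ends with a value returned by a last execution. -/
theorem exists_mem_doWhile {σ : Type v} {body : σ → Part (σ × Bool)} (I : σ → Prop)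
    {β : Type*} [Preorder β] [WellFoundedLT β] (m : σ → β)
    (hbody : ∀ s, I s → ∃ s' b, (s', b) ∈ body s ∧ (b = true → I s' ∧ m s' < m s)) (s : σ)
    (hs : I s) : ∃ s₁ s', I s₁ ∧ (s', false) ∈ body s₁ ∧ s' ∈ doWhile body s := by
  generalize hb : m s = b
  induction b using WellFoundedLT.induction generalizing s with
  | _ b ih =>
    obtain ⟨s', c, hmem, hc⟩ := hbody s hs
    cases c with
    | false => exact ⟨s, s', hs, hmem, (mem_doWhile _ _ _).2 (Or.inl hmem)⟩
    | true =>
      obtain ⟨hI, hlt⟩ := hc rfl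
      obtain ⟨s₁, s'', h1, h2, h3⟩ := ih _ (hb ▸ hlt) s' hI rfl
      exact ⟨s₁, s'', h1, h2, (mem_doWhile _ _ _).2 (Or.inr ⟨s', hmem, h3⟩)⟩

namespace TransSystem

variable {𝒜 : Type u} {S : Type v} {M : TransSystem 𝒜 S}

/-! ### Detection of divergent trees -/

theorem epsEdge_equiv {E : Setoid S} {B B' : S} {l : ActP 𝒜} (h : M.EpsEdge E B l B') : E B B' := by
  rcases h with ⟨-, -, h⟩ | ⟨k, p, Q, -, hQ, j, -, rfl⟩
  · exact h
  · exact hQ j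

theorem equiv_of_mem_epsVertices {E : Setoid S} {A B : S} (h : B ∈ M.epsVertices E A) : E A B := by
  change Relation.ReflTransGen (fun P Q => ∃ l, M.EpsEdge E P l Q) A B at h
  induction h with
  | refl => exact E.refl A
  | tail _ h ih => exact h.elim fun _ h => E.trans ih (epsEdge_equiv h)

theorem mem_epsVertices_of_edge {E : Setoid S} {A B B' : S} {l : ActP 𝒜}
    (h : B ∈ M.epsVertices E A) (he : M.EpsEdge E B l B') : B' ∈ M.epsVertices E A :=
  Relation.ReflTransGen.tail h ⟨l, he⟩

/-- The test of the algorithm inspects all probabilistic transitions of `B`; these are the branches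
of its only collective transition, so `B` survives exactly if it has a silent move into `und`. -/
theorem not_nonDiv_iff (hM : M.IsAlternating) {E : Setoid S} {A : S} {und : Set S}
    (hund : und ⊆ {B | E A B}) {B : S} (hB : E A B) :
    ¬ M.NonDiv E und B ↔ (∃ B' ∈ und, M.step B (.act .tau) B') ∨
      ∃ (k : ℕ) (p : Fin k → Set.Ioo (0 : ℝ) 1) (Q : Fin k → S), M.coll B k p Q ∧
        ∀ i, Q i ∈ und := by
  have hund' : ∀ {C}, C ∈ und → E B C := fun hC => E.trans (E.symm hB) (hund hC)
  rw [NonDiv, not_and_or]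
  push Not
  refine or_congr ?_ ?_
  · refine exists_congr fun B' => ⟨?_, fun ⟨h1, h2⟩ => ⟨Or.inl ⟨rfl, h2, hund' h1⟩, h1⟩⟩
    rintro ⟨⟨-, h, -⟩ | ⟨k, p, Q, -, -, j, h, -⟩, h'⟩
    · exact ⟨h', h⟩
    · cases h
  · constructor
    · rintro ⟨q, B', ⟨h, -⟩ | ⟨k, p, Q, hc, -⟩, h'⟩
      · cases h
      · exact ⟨k, p, Q, hc, fun i => h' _ _ (step_of_coll hM hc i)⟩
    · rintro ⟨k, p, Q, hc, hQ⟩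
      refine ⟨p ⟨0, by have := hM.two_le hc; omega⟩, _,
        Or.inr ⟨k, p, Q, hc, fun j => hund' (hQ j), _, rfl, rfl⟩, fun q B'' hs => ?_⟩
      obtain ⟨j, -, rfl⟩ := (hM.step_prob hc).1 hs
      exact hQ j

/-- The loop invariant of `detDivTree`. -/
structure DetInv (M : TransSystem 𝒜 S) (E : Setoid S) (A : S) (s : DetState S) : Prop where
  mem_ndiv : ∀ B, B ∈ s.ndiv ↔ B ∈ M.epsVertices E A ∧ B ∉ s.und
  subset : s.und ⊆ M.epsVertices E A
  trap : ∀ U ⊆ M.epsVertices E A, M.IsTrap U → U ⊆ s.und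

open Classical in
/-- One step of a pass of `detDivTree`. -/
noncomputable def detStep (M : TransSystem 𝒜 S) (E : Setoid S) (r : DetState S × Bool) (B : S) :
    DetState S × Bool :=
  if M.NonDiv E r.1.und B then (⟨r.1.ndiv ∪ {B}, r.1.und \ {B}⟩, true) else r

/-- A vertex that gets moved has no silent move into `und`, hence belongs to no trap contained in
`und`. -/
theorem detInv_step (hM : M.IsAlternating) {E : Setoid S} {A : S} {r : DetState S × Bool} {B : S}
    (hr : M.DetInv E A r.1) (hB : B ∈ M.epsVertices E A) : M.DetInv E A (M.detStep E r B).1 := by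
  unfold detStep
  split_ifs with hnd
  · refine ⟨fun C => ?_, Set.sdiff_subset.trans hr.subset, fun U hU hT C hC => ?_⟩
    · have := hr.mem_ndiv C
      by_cases h : C = B
      · subst h
        simp [hB]
      · simp [h, this]
    · refine ⟨hr.trap U hU hT hC, ?_⟩
      rintro rfl
      refine (not_nonDiv_iff hM (fun D hD => equiv_of_mem_epsVertices (hr.subset hD))
        (equiv_of_mem_epsVertices hB)).2 ?_ hnd
      have hsub := hr.trap U hU hT
      rcases hT C hC with ⟨B', hB', hs⟩ | ⟨k, p, Q, hc, hQ⟩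
      · exact Or.inl ⟨B', hsub hB', hs⟩
      · exact Or.inr ⟨k, p, Q, hc, fun i => hsub (hQ i)⟩
  · exact hr

theorem detDivBody_spec (hM : M.IsAlternating) {scan : Set S → List S} (hscan : IsScan scan)
    {E : Setoid S} {A : S} {s : DetState S} (hs : M.DetInv E A s) :
    M.DetInv E A (M.detDivBody scan E s).1 ∧
      ((M.detDivBody scan E s).2 = true → (M.detDivBody scan E s).1.und ⊂ s.und) ∧
      ((M.detDivBody scan E s).2 = false →
        (M.detDivBody scan E s).1 = s ∧ ∀ B ∈ s.und, ¬ M.NonDiv E s.und B) := by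
  -- The accumulator is general because the sets change during the pass. As long as the flag is
  -- false it still equals `s`, so after a pass without moves all tests refer to `s.und`.
  have key : ∀ (l : List S) (r : DetState S × Bool), M.DetInv E A r.1 → (∀ B ∈ l, B ∈ s.und) →
      r.1.und ⊆ s.und → (r.2 = true → r.1.und ⊂ s.und) → (r.2 = false → r.1 = s) →
      M.DetInv E A (l.foldl (M.detStep E) r).1 ∧
      ((l.foldl (M.detStep E) r).2 = true → (l.foldl (M.detStep E) r).1.und ⊂ s.und) ∧
      ((l.foldl (M.detStep E) r).2 = false → r.2 = false ∧ (l.foldl (M.detStep E) r).1 = s ∧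
        ∀ B ∈ l, ¬ M.NonDiv E s.und B) := by
    intro l
    induction l with
    | nil => exact fun r hr _ _ h h' => ⟨hr, h, fun hf => ⟨hf, h' hf, by simp⟩⟩
    | cons B l ih =>
      intro r hr hl hsub ht hf
      have hB := hl B List.mem_cons_self
      have hinv := detInv_step hM hr (hs.subset hB)
      have hl' : ∀ C ∈ l, C ∈ s.und := fun C hC => hl C (List.mem_cons_of_mem _ hC)
      rw [List.foldl_cons]
      by_cases hnd : M.NonDiv E r.1.und B
      · have he : M.detStep E r B = (⟨r.1.ndiv ∪ {B}, r.1.und \ {B}⟩, true) := if_pos hnd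
        rw [he] at hinv ⊢
        have hlt : r.1.und \ {B} ⊂ s.und := by
          refine ⟨Set.sdiff_subset.trans hsub, fun h => ?_⟩
          exact (h hB).2 rfl
        obtain ⟨h1, h2, h3⟩ := ih _ hinv hl' hlt.1 (fun _ => hlt) (fun h => by cases h)
        exact ⟨h1, h2, fun h => by cases (h3 h).1⟩
      · have he : M.detStep E r B = r := if_neg hnd
        rw [he]
        obtain ⟨h1, h2, h3⟩ := ih r hr hl' hsub ht hf
        refine ⟨h1, h2, fun h => ⟨(h3 h).1, (h3 h).2.1, ?_⟩⟩
        rw [hf (h3 h).1] at hnd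
        simpa [hnd] using (h3 h).2.2
  obtain ⟨h1, h2, h3⟩ := key (scan s.und) (s, false) hs (fun B hB => (hscan _ _).1 hB) subset_rfl
    (fun h => by cases h) fun _ => rfl
  exact ⟨h1, h2, fun h => ⟨(h3 h).2.1, fun B hB => (h3 h).2.2 B ((hscan _ _).2 hB)⟩⟩

theorem detInv_init (hM : M.IsAlternating) (E : Setoid S) (A : S) :
    M.DetInv E A ⟨M.epsSinks E A, M.epsVertices E A \ M.epsSinks E A⟩ := by
  refine ⟨fun B => ?_, Set.sdiff_subset, fun U hU hT B hB => ⟨hU hB, fun hsink => ?_⟩⟩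
  · constructor
    · exact fun h => ⟨h.1, fun h' => h'.2 h⟩
    · rintro ⟨h1, h2⟩
      by_contra h
      exact h2 ⟨h1, h⟩
  · have hE : ∀ C ∈ U, E B C := fun C hC =>
      E.trans (E.symm (equiv_of_mem_epsVertices (hU hB))) (equiv_of_mem_epsVertices (hU hC))
    rcases hT B hB with ⟨B', hB', hs⟩ | ⟨k, p, Q, hc, hQ⟩
    · exact hsink.2 _ _ (Or.inl ⟨rfl, hs, hE _ hB'⟩)
    · exact hsink.2 _ _ (Or.inr ⟨k, p, Q, hc, fun i => hE _ (hQ i),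
        ⟨0, two_pos.trans_le (hM.two_le hc)⟩, rfl, rfl⟩)

open Classical in
-- When the loop stops, no undecided vertex can be moved, so `und` is a trap; by the invariant it
-- contains every trap in the ε-graph.
theorem detDivTree_eq [Finite S] (hM : M.IsAlternating) {scan : Set S → List S}
    (hscan : IsScan scan) (E : Setoid S) (A : S) :
    M.detDivTree scan E A = Part.some (decide (M.Diverges E A)) := by
  obtain ⟨s₁, s, hs₁, hlast, hs⟩ := exists_mem_doWhile
    (body := fun s => Part.some (M.detDivBody scan E s)) (M.DetInv E A) DetState.und
    (fun s hs => ⟨_, _, Part.mem_some _, fun h =>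
      ⟨(detDivBody_spec hM hscan hs).1, (detDivBody_spec hM hscan hs).2.1 h⟩⟩) _
    (detInv_init hM E A)
  obtain ⟨-, -, h3⟩ := detDivBody_spec hM hscan hs₁
  rw [Part.mem_some_iff] at hlast
  rw [← hlast] at h3
  obtain ⟨rfl, hnd⟩ := h3 rfl
  rw [detDivTree, Part.eq_some_iff.2 hs, Part.map_some]
  congr 1
  have hA : A ∈ M.epsVertices E A := Relation.ReflTransGen.refl
  have hsub : s.und ⊆ {B | E A B} := fun B hB => equiv_of_mem_epsVertices (hs₁.subset hB)
  have hiff : A ∈ s.ndiv ↔ ¬ M.Diverges E A := by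
    rw [hs₁.mem_ndiv, and_iff_right hA, not_iff_not, diverges_iff hM]
    constructor
    · exact fun h => ⟨s.und, h, fun B hB => hsub hB, fun B hB =>
        (not_nonDiv_iff hM hsub (hsub hB)).1 (hnd B hB)⟩
    · rintro ⟨U, hAU, hE, hU⟩
      -- Moves inside a trap within one class are edges of the ε-graph, so the trap can be
      -- restricted to the vertices.
      refine hs₁.trap (U ∩ M.epsVertices E A) Set.inter_subset_right ?_ ⟨hAU, hA⟩
      rintro B ⟨hB, hBV⟩
      have hE' : ∀ C ∈ U, E B C := fun C hC => E.trans (E.symm (hE B hB)) (hE C hC)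
      rcases hU B hB with ⟨B', hB', hs⟩ | ⟨k, p, Q, hc, hQ⟩
      · exact Or.inl ⟨B', ⟨hB', mem_epsVertices_of_edge hBV (Or.inl ⟨rfl, hs, hE' _ hB'⟩)⟩, hs⟩
      · exact Or.inr ⟨k, p, Q, hc, fun i => ⟨hQ i, mem_epsVertices_of_edge hBV
          (Or.inr ⟨k, p, Q, hc, fun i => hE' _ (hQ i), i, rfl, rfl⟩)⟩⟩
  by_cases h : M.Diverges E A <;> simp [hiff, h]

/-! ### The main loop -/

theorem findDivSplit_spec [Finite S] (hM : M.IsAlternating) {scan : Set S → List S}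
    (hscan : IsScan scan) {scanPairs : Set (S × S) → List (S × S)} (hpairs : IsScan scanPairs)
    (E : Setoid S) : ∃ o, M.findDivSplit scan scanPairs E = Part.some o ∧
      (o = none → M.IsDivPreserving E) ∧
      ∀ P, o = some P → ∃ Q, E P Q ∧ ¬ (M.Diverges E P ↔ M.Diverges E Q) := by
  classical
  have key : ∀ l : List (S × S), ∃ o, M.findDivSplitLoop scan E l = Part.some o ∧
      (o = none → ∀ x ∈ l, (M.Diverges E x.1 ↔ M.Diverges E x.2)) ∧
      ∀ P, o = some P → ∃ Q, (P, Q) ∈ l ∧ ¬ (M.Diverges E P ↔ M.Diverges E Q) := by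
    intro l
    induction l with
    | nil => exact ⟨none, rfl, by simp, by simp⟩
    | cons x l ih =>
      obtain ⟨P, Q⟩ := x
      simp only [findDivSplitLoop, detDivTree_eq hM hscan, Part.bind_some]
      by_cases h : M.Diverges E P ↔ M.Diverges E Q
      · obtain ⟨o, h1, h2, h3⟩ := ih
        refine ⟨o, by simpa [h] using h1, fun ho => ?_, fun R hR => ?_⟩
        · simpa [h] using h2 ho
        · obtain ⟨R', hR', hn⟩ := h3 R hR
          exact ⟨R', List.mem_cons_of_mem _ hR', hn⟩
      · refine ⟨some P, by simp [h], by simp, ?_⟩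
        rintro _ ⟨⟩
        exact ⟨Q, List.mem_cons_self, h⟩
  obtain ⟨o, h1, h2, h3⟩ := key (scanPairs {x | E x.1 x.2})
  refine ⟨o, h1, fun ho P Q hPQ => h2 ho (P, Q) ((hpairs _ _).2 hPQ), fun P hP => ?_⟩
  obtain ⟨Q, hQ, hn⟩ := h3 P hP
  exact ⟨Q, (hpairs _ _).1 hQ, hn⟩

theorem divRefineLoop_eq [Finite S] (hM : M.IsAlternating) {scan : Set S → List S}
    (hscan : IsScan scan) (E : Setoid S) (l : List S) (C : Set S × Set S) :
    M.divRefineLoop scan E l C = Part.some (C.1 ∪ {Q | Q ∈ l ∧ M.Diverges E Q},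
      C.2 ∪ {Q | Q ∈ l ∧ ¬ M.Diverges E Q}) := by
  classical
  induction l generalizing C with
  | nil => simp [divRefineLoop]
  | cons Q l ih =>
    simp only [divRefineLoop, detDivTree_eq hM hscan, Part.bind_some, ih]
    congr 2
    · ext x
      by_cases h : M.Diverges E Q <;> by_cases hx : x = Q <;> simp [h, hx]
    · ext x
      by_cases h : M.Diverges E Q <;> by_cases hx : x = Q <;> simp [h, hx]

theorem divRefine_spec [Finite S] (hM : M.IsAlternating) {scan : Set S → List S}
    (hscan : IsScan scan) (E : Setoid S) (P : S) :
    ∃ R, M.divRefine scan E P = Part.some R ∧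
      ∀ x y, R x y ↔ E x y ∧ (E x P → (M.Diverges E x ↔ M.Diverges E y)) := by
  have hmem : ∀ Q, Q ∈ scan {Q | E Q P} ↔ E Q P := fun Q => hscan _ _
  refine ⟨ofBlocks ((E.classes \ {{Q | E Q P}}) ∪ {{Q | E Q P ∧ M.Diverges E Q},
    {Q | E Q P ∧ ¬ M.Diverges E Q}}), ?_, fun x y => ?_⟩
  · rw [divRefine, divRefineLoop_eq hM hscan, Part.map_some]
    simp only [hmem, Set.empty_union]
  constructor
  · intro h
    have h1 := h {Q | E Q P ∧ M.Diverges E Q} (by simp)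
    have h2 := h {Q | E Q P ∧ ¬ M.Diverges E Q} (by simp)
    simp only [Set.mem_ofPred_eq] at h1 h2
    by_cases hx : E x P
    · have hy : E y P := by tauto
      exact ⟨E.trans hx (E.symm hy), fun _ => by tauto⟩
    · refine ⟨?_, fun h => absurd h hx⟩
      -- Outside the class of `P` the old classes are still blocks.
      have h3 := h {z | E z x} (Or.inl ⟨⟨x, rfl⟩, fun he => hx ?_⟩)
      · exact E.symm (h3.1 (E.refl x))
      · have : x ∈ {z | E z x} := E.refl x
        rwa [Set.mem_singleton_iff.1 he] at this
  · rintro ⟨hxy, hdiv⟩ b (⟨⟨z, rfl⟩, -⟩ | rfl | rfl)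
    · exact ⟨fun h => E.trans (E.symm hxy) h, fun h => E.trans hxy h⟩
    · have : E x P ↔ E y P := ⟨fun h => E.trans (E.symm hxy) h, fun h => E.trans hxy h⟩
      simp only [Set.mem_ofPred_eq]
      tauto
    · have : E x P ↔ E y P := ⟨fun h => E.trans (E.symm hxy) h, fun h => E.trans hxy h⟩
      simp only [Set.mem_ofPred_eq]
      tauto

theorem quotient_le (E : Setoid S) : M.quotient E ≤ E := sSup_le fun _ h => h.2

theorem le_quotient {E F : Setoid S} (hF : M.IsBranchingBisim F) (h : F ≤ E) : F ≤ M.quotient E :=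
  le_sSup ⟨hF, h⟩

theorem isBranchingBisim_quotient (hM : M.IsAlternating) (E : Setoid S) :
    M.IsBranchingBisim (M.quotient E) :=
  (Simulates.sSup fun _ h => h.1.simulates hM).isBranchingBisim hM

/-- The main loop ends with the largest branching bisimulation with explicit divergence. -/
theorem exists_mem_mainLoop [Finite S] (hM : M.IsAlternating) {scan : Set S → List S}
    (hscan : IsScan scan) {scanPairs : Set (S × S) → List (S × S)} (hpairs : IsScan scanPairs) :
    ∃ E ∈ M.mainLoop scan scanPairs, M.IsBranchingBisimDiv E ∧
      ∀ F, M.IsBranchingBisimDiv F → F ≤ E := by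
  have : Finite (Setoid S) := Finite.of_injective (fun E : Setoid S => (E : S → S → Prop))
    fun _ _ h => Setoid.ext fun x y => iff_of_eq (congrFun (congrFun h x) y)
  have hbody : ∀ s : MainState S, ∃ o,
      M.findDivSplit scan scanPairs (M.quotient s.Eini) = Part.some o ∧
      (o = none → M.IsDivPreserving (M.quotient s.Eini)) ∧
      ∀ P, o = some P → ∃ Q, M.quotient s.Eini P Q ∧
        ¬ (M.Diverges (M.quotient s.Eini) P ↔ M.Diverges (M.quotient s.Eini) Q) :=
    fun s => findDivSplit_spec hM hscan hpairs _
  -- Invariant: every branching bisimulation with explicit divergence lies below `Eini`. Measure: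
  -- `Eini` itself, well-founded because there are finitely many equivalences.
  have hstep : ∀ s : MainState S, (∀ F, M.IsBranchingBisimDiv F → F ≤ s.Eini) →
      ∃ s' b, (s', b) ∈ M.mainBody scan scanPairs s ∧ (b = true →
        (∀ F, M.IsBranchingBisimDiv F → F ≤ s'.Eini) ∧ s'.Eini < s.Eini) := by
    intro s hs
    obtain ⟨o, h1, h2, h3⟩ := hbody s
    rw [mainBody, h1, Part.bind_some]
    cases o with
    | none => exact ⟨_, false, Part.mem_some _, fun h => by cases h⟩
    | some P =>
      obtain ⟨Q, hPQ, hn⟩ := h3 P rfl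
      obtain ⟨R, hR, hRE⟩ := divRefine_spec hM hscan (M.quotient s.Eini) P
      simp only [hR, Part.map_some]
      refine ⟨_, true, Part.mem_some _, fun _ => ⟨fun F hF x y hxy => ?_, ?_⟩⟩
      · have hFE := le_quotient hF.1 (hs F hF)
        have hdiv : ∀ {x y}, F x y → M.Diverges (M.quotient s.Eini) x →
            M.Diverges (M.quotient s.Eini) y :=
          (hF.1.simulates hM).diverges_of_le hM hF.2 hFE
        exact (hRE x y).2 ⟨hFE hxy, fun _ => ⟨hdiv hxy, hdiv (F.symm hxy)⟩⟩
      · refine lt_of_lt_of_le ?_ (quotient_le (M := M) s.Eini)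
        refine lt_of_le_not_ge (fun x y hxy => ((hRE x y).1 hxy).1) fun hle => ?_
        -- The splitter pair `P`, `Q` is no longer related, so the refinement is strict.
        exact hn (((hRE P Q).1 (hle hPQ)).2 ((M.quotient s.Eini).refl P))
  obtain ⟨s₁, s, hs₁, hlast, hs⟩ := exists_mem_doWhile (body := M.mainBody scan scanPairs)
    (fun s => ∀ F, M.IsBranchingBisimDiv F → F ≤ s.Eini) MainState.Eini hstep ⟨⊤, ⊤⟩
    fun F _ => le_top
  refine ⟨s.E, Part.mem_map _ hs, ?_⟩
  obtain ⟨o, h1, h2, h3⟩ := hbody s₁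
  rw [mainBody, h1, Part.bind_some] at hlast
  cases o with
  | none =>
    obtain ⟨rfl, -⟩ := Prod.mk.inj (Part.mem_some_iff.1 hlast)
    exact ⟨⟨isBranchingBisim_quotient hM _, h2 rfl⟩, fun F hF => le_quotient hF.1 (hs₁ F hF)⟩
  | some P =>
    obtain ⟨R, -, hR⟩ := (Part.mem_map_iff _).1 hlast
    cases (Prod.mk.inj hR).2

end TransSystem

namespace Term

variable {𝒜 : Type u}

/-! ### Finiteness of the set of reachable terms -/

/-- Simultaneous substitution. It is only used for closed terms and variables that cannot be
captured. -/
def inst : Term 𝒜 → (ℕ → Term 𝒜) → Term 𝒜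
  | nil, _ => nil
  | var X, σ => σ X
  | choice n α T, σ => choice n α fun i => (T i).inst σ
  | pchoice n p hp T, σ => pchoice n p hp fun i => (T i).inst σ
  | mu X T, σ => mu X (T.inst (Function.update σ X (var X)))

/-- A set of terms that contains the instance of `T` under `σ` and, up to the transitions of the
substituted terms, is closed under transitions. -/
def derivs : Term 𝒜 → (ℕ → Term 𝒜) → Set (Term 𝒜)
  | nil, _ => {nil}
  | var X, σ => {σ X}
  | choice n α T, σ => {(choice n α T).inst σ} ∪ ⋃ i, (T i).derivs σ
  | pchoice n p hp T, σ => {(pchoice n p hp T).inst σ} ∪ ⋃ i, (T i).derivs σ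
  | mu X T, σ => {(mu X T).inst σ} ∪ T.derivs (Function.update σ X ((mu X T).inst σ))

theorem finite_derivs (T : Term 𝒜) (σ : ℕ → Term 𝒜) : (T.derivs σ).Finite := by
  induction T generalizing σ with
  | nil => exact Set.finite_singleton _
  | var X => exact Set.finite_singleton _
  | choice n α T ih => exact (Set.finite_singleton _).union (Set.finite_iUnion fun i => ih i σ)
  | pchoice n p hp T ih => exact (Set.finite_singleton _).union (Set.finite_iUnion fun i => ih i σ)
  | mu X T ih => exact (Set.finite_singleton _).union (ih _)

theorem inst_mem_derivs (T : Term 𝒜) (σ : ℕ → Term 𝒜) : T.inst σ ∈ T.derivs σ := by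
  cases T with
  | nil => exact rfl
  | var X => exact rfl
  | choice n α T => exact Or.inl rfl
  | pchoice n p hp T => exact Or.inl rfl
  | mu X T => exact Or.inl rfl

theorem inst_var (T : Term 𝒜) : T.inst var = T := by
  induction T with
  | nil => rfl
  | var X => rfl
  | choice n α T ih => simp [inst, ih]
  | pchoice n p hp T ih => simp [inst, ih]
  | mu X T ih => simp [inst, ih]

theorem exists_mem_fv_of_inst {T : Term 𝒜} {σ : ℕ → Term 𝒜} {Z : ℕ} (h : Z ∈ (T.inst σ).fv) :
    ∃ Y ∈ T.fv, Z ∈ (σ Y).fv := by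
  induction T generalizing σ with
  | nil => exact h.elim
  | var X => exact ⟨X, rfl, h⟩
  | choice n α T ih =>
    obtain ⟨i, hi⟩ := Set.mem_iUnion.1 h
    obtain ⟨Y, hY, hZ⟩ := ih i hi
    exact ⟨Y, Set.mem_iUnion.2 ⟨i, hY⟩, hZ⟩
  | pchoice n p hp T ih =>
    obtain ⟨i, hi⟩ := Set.mem_iUnion.1 h
    obtain ⟨Y, hY, hZ⟩ := ih i hi
    exact ⟨Y, Set.mem_iUnion.2 ⟨i, hY⟩, hZ⟩
  | mu X T ih =>
    obtain ⟨Y, hY, hZ⟩ := ih h.1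
    by_cases hYX : Y = X
    · subst hYX
      rw [Function.update_self] at hZ
      exact absurd hZ h.2
    · rw [Function.update_of_ne hYX] at hZ
      exact ⟨Y, ⟨hY, hYX⟩, hZ⟩

theorem subst_of_notMem_fv {T : Term 𝒜} {X : ℕ} (P : Term 𝒜) (h : X ∉ T.fv) :
    T.subst X P = T := by
  induction T with
  | nil => rfl
  | var Y => exact if_neg fun hY => h hY.symm
  | choice n α T ih =>
    have := fun i => ih i fun hi => h (Set.mem_iUnion.2 ⟨i, hi⟩)
    simp [subst, this]
  | pchoice n p hp T ih =>
    have := fun i => ih i fun hi => h (Set.mem_iUnion.2 ⟨i, hi⟩)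
    simp [subst, this]
  | mu Y T ih =>
    by_cases hY : Y = X
    · exact if_pos hY
    · rw [subst, if_neg hY, ih fun hX => h ⟨hX, fun e => hY e.symm⟩]

/-- Unfolding the instance of a recursion is instantiating its body with `X` sent to the whole
instance. The hypothesis keeps the substitution from touching the terms that `σ` inserts. -/
theorem inst_subst {T : Term 𝒜} {σ : ℕ → Term 𝒜} {X : ℕ} (P : Term 𝒜)
    (h : ∀ Y ∈ T.fv, Y ≠ X → X ∉ (σ Y).fv) :
    (T.inst (Function.update σ X (var X))).subst X P = T.inst (Function.update σ X P) := by
  induction T generalizing σ with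
  | nil => rfl
  | var Y =>
    by_cases hY : Y = X
    · subst hY
      simp [inst, subst]
    · simpa [inst, hY] using subst_of_notMem_fv P (h Y rfl hY)
  | choice n α T ih =>
    have := fun i => ih i (σ := σ) fun Y hY => h Y (Set.mem_iUnion.2 ⟨i, hY⟩)
    simp [inst, subst, this]
  | pchoice n p hp T ih =>
    have := fun i => ih i (σ := σ) fun Y hY => h Y (Set.mem_iUnion.2 ⟨i, hY⟩)
    simp [inst, subst, this]
  | mu Y T ih =>
    by_cases hY : Y = X
    · subst hY
      simp [inst, subst]
    · simp only [inst, subst, if_neg hY, mu.injEq, true_and]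
      rw [Function.update_comm (Ne.symm hY), ih, Function.update_comm hY]
      intro Z hZ hZX
      by_cases hZY : Z = Y
      · subst hZY
        rw [Function.update_self]
        exact fun e => hZX (Set.mem_singleton_iff.1 e).symm
      · rw [Function.update_of_ne hZY]
        exact h Z ⟨hZ, hZY⟩ hZX

/-- `T` has a transition to `T'` the derivation of which unfolds at most `n` recursions. -/
inductive StepIn : ℕ → Term 𝒜 → Term 𝒜 → Prop
  | choice (m n : ℕ) (α : Fin (n + 1) → Act 𝒜) (T : Fin (n + 1) → Term 𝒜) (i : Fin (n + 1)) :
      StepIn m (.choice n α T) (T i)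
  | pchoice (m n : ℕ) (p : Fin (n + 2) → Set.Ioo (0 : ℝ) 1) (hp : ∑ i, (p i : ℝ) = 1)
      (T : Fin (n + 2) → Term 𝒜) (i : Fin (n + 2)) : StepIn m (.pchoice n p hp T) (T i)
  | mu (m : ℕ) (X : ℕ) (T T' : Term 𝒜) : StepIn m (T.subst X (.mu X T)) T' →
      StepIn (m + 1) (.mu X T) T'

theorem StepIn.succ {n : ℕ} {T T' : Term 𝒜} (h : StepIn n T T') : StepIn (n + 1) T T' := by
  induction h with
  | choice => exact .choice ..
  | pchoice => exact .pchoice ..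
  | mu _ _ _ _ _ ih => exact .mu _ _ _ _ ih

theorem Step.exists_stepIn {T T' : Term 𝒜} {l : ActP 𝒜} (h : Step T l T') :
    ∃ n, StepIn n T T' := by
  induction h with
  | choice => exact ⟨0, .choice ..⟩
  | pchoice => exact ⟨0, .pchoice ..⟩
  | mu _ _ _ _ _ ih => exact ih.imp' _ fun n h => .mu n _ _ _ h

/-- Apart from the terms substituted for free variables, no transition leaves `derivs`. For a
recursion the inserted terms include its own instance `R`, which would make the argument circular;
the bound on the number of unfoldings breaks the circle. -/
theorem derivs_closed {T : Term 𝒜} {σ : ℕ → Term 𝒜} (hσ : ∀ Y ∈ T.fv, (σ Y).fv = ∅) {n : ℕ}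
    {P P' : Term 𝒜} (hP : P ∈ T.derivs σ) (h : StepIn n P P') :
    P' ∈ T.derivs σ ∨ ∃ Y ∈ T.fv, StepIn n (σ Y) P' := by
  induction T generalizing σ n P with
  | nil =>
    obtain rfl : P = nil := hP
    cases h
  | var X =>
    obtain rfl : P = σ X := hP
    exact Or.inr ⟨X, rfl, h⟩
  | choice m α T ih =>
    rcases hP with hP | hP
    · obtain rfl : P = _ := hP
      cases h with
      | choice _ _ _ _ i =>
        exact Or.inl (Or.inr (Set.mem_iUnion.2 ⟨i, inst_mem_derivs _ _⟩))
    · obtain ⟨i, hi⟩ := Set.mem_iUnion.1 hP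
      rcases ih i (fun Y hY => hσ Y (Set.mem_iUnion.2 ⟨i, hY⟩)) hi h with h | ⟨Y, hY, h⟩
      · exact Or.inl (Or.inr (Set.mem_iUnion.2 ⟨i, h⟩))
      · exact Or.inr ⟨Y, Set.mem_iUnion.2 ⟨i, hY⟩, h⟩
  | pchoice m p hp T ih =>
    rcases hP with hP | hP
    · obtain rfl : P = _ := hP
      cases h with
      | pchoice _ _ _ _ _ i =>
        exact Or.inl (Or.inr (Set.mem_iUnion.2 ⟨i, inst_mem_derivs _ _⟩))
    · obtain ⟨i, hi⟩ := Set.mem_iUnion.1 hP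
      rcases ih i (fun Y hY => hσ Y (Set.mem_iUnion.2 ⟨i, hY⟩)) hi h with h | ⟨Y, hY, h⟩
      · exact Or.inl (Or.inr (Set.mem_iUnion.2 ⟨i, h⟩))
      · exact Or.inr ⟨Y, Set.mem_iUnion.2 ⟨i, hY⟩, h⟩
  | mu X T ih =>
    set R := (mu X T).inst σ with hR
    have hRfv : R.fv = ∅ := by
      refine Set.eq_empty_of_forall_notMem fun Z hZ => ?_
      obtain ⟨Y, hY, hZ⟩ := exists_mem_fv_of_inst hZ
      rw [hσ Y hY] at hZ
      exact hZ
    have hσ' : ∀ Y ∈ T.fv, (Function.update σ X R Y).fv = ∅ := by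
      intro Y hY
      by_cases hYX : Y = X
      · rw [hYX, Function.update_self, hRfv]
      · rw [Function.update_of_ne hYX, hσ Y ⟨hY, hYX⟩]
    have hunf : ∀ n, StepIn n R P' →
        P' ∈ (mu X T).derivs σ ∨ ∃ Y ∈ (mu X T).fv, StepIn n (σ Y) P' := by
      intro n
      induction n with
      | zero =>
        intro h
        rw [hR, inst] at h
        cases h
      | succ n ihn =>
        intro h
        have h' : StepIn n (T.inst (Function.update σ X R)) P' := by
          rw [← inst_subst R fun Y hY hYX hX => by
            rw [hσ Y ⟨hY, hYX⟩] at hX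
            exact hX]
          rw [hR, inst] at h ⊢
          cases h
          assumption
        rcases ih hσ' (inst_mem_derivs _ _) h' with h | ⟨Y, hY, h⟩
        · exact Or.inl (Or.inr h)
        -- A transition inherited from `R` is now derived with one unfolding less, so `ihn` applies.
        · by_cases hYX : Y = X
          · subst hYX
            rw [Function.update_self] at h
            exact (ihn h).imp id fun ⟨Z, hZ, h⟩ => ⟨Z, hZ, h.succ⟩
          · rw [Function.update_of_ne hYX] at h
            exact Or.inr ⟨Y, ⟨hY, hYX⟩, h.succ⟩
    rcases hP with hP | hP
    · obtain rfl : P = R := hP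
      exact hunf n h
    · rcases ih hσ' hP h with h | ⟨Y, hY, h⟩
      · exact Or.inl (Or.inr h)
      · by_cases hYX : Y = X
        · subst hYX
          rw [Function.update_self] at h
          exact hunf n h
        · rw [Function.update_of_ne hYX] at h
          exact Or.inr ⟨Y, ⟨hY, hYX⟩, h⟩

/-! ### Collective silent transitions -/

section Coll

variable {A B : Term 𝒜} {k k' : ℕ} {p : Fin k → Set.Ioo (0 : ℝ) 1} {Q : Fin k → Term 𝒜}
  {p' : Fin k' → Set.Ioo (0 : ℝ) 1} {Q' : Fin k' → Term 𝒜}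

theorem Coll.two_le (h : Coll A k p Q) : 2 ≤ k := by
  induction h with
  | pchoice => omega
  | mu _ _ _ _ _ _ ih => exact ih

theorem Coll.sum_eq (h : Coll A k p Q) : ∑ i, (p i : ℝ) = 1 := by
  induction h with
  | pchoice _ _ hp => exact hp
  | mu _ _ _ _ _ _ ih => exact ih

theorem Coll.unique (h : Coll A k p Q) (h' : Coll A k' p' Q') :
    (⟨k, p, Q⟩ : Σ k, (Fin k → Set.Ioo (0 : ℝ) 1) × (Fin k → Term 𝒜)) = ⟨k', p', Q'⟩ := by
  induction h with
  | pchoice => cases h'; rfl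
  | mu _ _ _ _ _ _ ih =>
    cases h' with
    | mu _ _ _ _ _ h' => exact ih h'

theorem Coll.not_act (h : Coll A k p Q) (α : Act 𝒜) : ¬ Step A (.act α) B := by
  induction h with
  | pchoice => rintro ⟨⟩
  | mu _ _ _ _ _ _ ih =>
    intro h
    cases h with
    | mu _ _ _ _ h => exact ih h

theorem Coll.step_prob (h : Coll A k p Q) (q : Set.Ioo (0 : ℝ) 1) :
    Step A (.prob q) B ↔ ∃ j, q = p j ∧ B = Q j := by
  induction h with
  | pchoice n p hp T =>
    constructor
    · intro h
      cases h with
      | pchoice _ _ _ _ i => exact ⟨i, rfl, rfl⟩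
    · rintro ⟨i, rfl, rfl⟩
      exact .pchoice ..
  | mu _ _ _ _ _ _ ih =>
    rw [← ih]
    constructor
    · intro h
      cases h with
      | mu _ _ _ _ h => exact h
    · exact .mu _ _ _ _

end Coll

end Term

/-! ### Processes form an alternating system -/

variable {𝒜 : Type u}

theorem finite_reach_rccs (A : Proc 𝒜) : ((rccs 𝒜).reach A).Finite := by
  refine Set.Finite.of_finite_image (f := Subtype.val) ?_ Subtype.val_injective.injOn
  refine (A.1.finite_derivs Term.var).subset ?_
  rintro _ ⟨B, hB, rfl⟩
  change Relation.ReflTransGen (fun P Q => ∃ l, (rccs 𝒜).step P l Q) A B at hB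
  have hfv : ∀ Y, Y ∉ A.1.fv := fun Y hY => by
    rw [A.2.2] at hY
    exact hY
  induction hB with
  | refl => simpa only [Term.inst_var] using A.1.inst_mem_derivs Term.var
  | tail _ h ih =>
    obtain ⟨l, h⟩ := h
    obtain ⟨n, hn⟩ := Term.Step.exists_stepIn h
    -- A process has no free variables, so no transition can come from a substituted term.
    exact (Term.derivs_closed (fun Y hY => absurd hY (hfv Y)) ih hn).resolve_right
      fun ⟨Y, hY, _⟩ => hfv Y hY

theorem isAlternating_rccs (𝒜 : Type u) : (rccs 𝒜).IsAlternating where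
  two_le h := Term.Coll.two_le h
  sum_eq h := Term.Coll.sum_eq h
  unique {A k p Q k' p' Q'} h h' := by
    obtain ⟨rfl, h2⟩ := Sigma.mk.inj_iff.1 (Term.Coll.unique h h')
    obtain ⟨rfl, h3⟩ := Prod.mk.inj (eq_of_heq h2)
    obtain rfl : Q = Q' := funext fun i => Subtype.ext (congrFun h3 i)
    rfl
  not_act h := Term.Coll.not_act h _
  step_prob h := (Term.Coll.step_prob h _).trans <| exists_congr fun _ => and_congr_right fun _ =>
    Subtype.ext_iff.symm
  finite_reach := finite_reach_rccs

end RCCS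

theorem theorem5p5 {𝒜 : Type*} (A B : RCCS.Proc 𝒜) :
    Finite (RCCS.ReachSum A B) ∧
    ∀ (scan : Set (RCCS.ReachSum A B) → List (RCCS.ReachSum A B))
      (scanPairs : Set (RCCS.ReachSum A B × RCCS.ReachSum A B) →
        List (RCCS.ReachSum A B × RCCS.ReachSum A B)),
      RCCS.IsScan scan → RCCS.IsScan scanPairs →
      ∃ b : Bool, b ∈ RCCS.divBranBisim A B scan scanPairs ∧
        (b = true ↔ RCCS.BranBisimDiv A B) := by
  have hA := (RCCS.finite_reach_rccs A).to_subtype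
  have hB := (RCCS.finite_reach_rccs B).to_subtype
  refine ⟨inferInstance, fun scan scanPairs hscan hpairs => ?_⟩
  have hM := RCCS.isAlternating_rccs 𝒜
  have hN : (RCCS.reachSystem A B).IsAlternating := (hM.restrict _).disjUnion (hM.restrict _)
  have hf := RCCS.TransSystem.isFunctionalBisim_disjUnion hM A B
  obtain ⟨E, hE, hdiv, hmax⟩ := RCCS.TransSystem.exists_mem_mainLoop hN hscan hpairs
  refine ⟨_, Part.mem_map _ hE, ?_⟩
  refine (@decide_eq_true_iff _ (_)).trans ⟨?_, ?_⟩
  · intro hAB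
    -- Maximality of the computed equivalence is what lets it be pushed forward to all processes.
    obtain ⟨E', hE', rfl⟩ := RCCS.TransSystem.exists_comap_eq hf hM hN hdiv hmax
    exact ⟨E', hE', hAB⟩
  · rintro ⟨F, hF, hAB⟩
    exact hmax _ (hF.comap hf hM hN) hAB
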